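/- An instance of the unsplittable flow problem on a path (UFPP) consists of a path with vertices $0,1,\dots,m$ and edges $\{e,e+1\}$, $0\le e<m$, with capacities $u_e\in\mathbb{N}$, and of tasks $1,\dots,n$, where task $i$ has a start vertex $s_i$ and an end vertex $t_i$ with $s_i<t_i$, a demand $d_i\in\mathbb{N}$ and a profit $w_i\in\mathbb{N}$ (here $0\in\mathbb{N}$). Task $i$ uses the edges of the path from $s_i$ to $t_i$. A set $F$ of tasks is feasible if on every edge $e$ the total demand of the tasks of $F$ that use $e$ is at most $u_e$; its profit is $w(F)=\sum_{i\in F}w_i$. Let $b(i)$ be the minimum capacity of an edge used by $i$, and let $\ell(i)=b(i)-d_i$. Task $i$ is $\delta$-large if $d_i>\delta\, b(i)$. To task $i$ belongs the rectangle $[s_i,t_i]\times[\ell(i),b(i)]$, drawn as high as possible under the capacity profile. A set $F$ of tasks is an independent task set (ITS) if $\ell(i)\ge 0$ for all $i\in F$ and the rectangles of any two distinct tasks $i,j\in F$ do not overlap, that is, $t_i\le s_j$ or $t_j\le s_i$ or $b(i)\le\ell(j)$ or $b(j)\le\ell(i)$. Theorem. Let $k\ge 2$ be an integer. (a) There is a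 $2k$-approximation algorithm for UFPP restricted to instances in which every task is $\frac1k$-large, with running time $O(n^4+m)$, hence $O(n^4)$ on instances with $m<2n$. More precisely, there are a word-RAM program with unit-cost operations and constants $C,c$ such that on every such instance the program halts after at most $C(n^4+m+1)$ steps, and after at most $Cn^4$ steps if $m<2n$, computes only numbers that are at most $N^c$, where $N=n+m+\sum_e u_e+\sum_i d_i+\sum_i w_i+2$, and returns a set $F$ of tasks that is an ITS of maximum profit, is feasible, and satisfies $w(F)\ge\frac1{2k}w(F^*)$ for every feasible set $F^*$. (b) In every UFPP instance, every feasible set $F$ all of whose tasks are $\frac1k$-large can be partitioned into $2k$ (possibly empty) independent task sets. -/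

import Mathlib

/-! ### Unsplittable flow on a path -/

/-- An instance of the unsplittable flow problem on a path: the path has vertices `0, …, m` and
edges `e = {e, e + 1}` for `e < m`, with capacities `u`; task `i` goes from vertex `s i` to
vertex `t i`, with demand `d i` and profit `w i`. -/
structure UFPP where
  m : ℕ
  n : ℕ
  u : Fin m → ℕ
  s : Fin n → Fin (m + 1)
  t : Fin n → Fin (m + 1)
  d : Fin n → ℕ
  w : Fin n → ℕ
  s_lt_t : ∀ i, s i < t i

namespace UFPP

/-- Task `i` uses the edge `e = {e, e + 1}`: the edge lies on the path from `s i` to `t i`. -/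
def Uses (I : UFPP) (i : Fin I.n) (e : Fin I.m) : Prop :=
  I.s i ≤ e.castSucc ∧ e.succ ≤ I.t i

instance (I : UFPP) (i : Fin I.n) (e : Fin I.m) : Decidable (I.Uses i e) :=
  inferInstanceAs (Decidable (_ ∧ _))

/-- The set of edges used by task `i`. -/
def path (I : UFPP) (i : Fin I.n) : Finset (Fin I.m) :=
  Finset.univ.filter (fun e => I.Uses i e)

theorem path_nonempty (I : UFPP) (i : Fin I.n) : (I.path i).Nonempty := by
  have h : (I.s i : ℕ) < I.t i := I.s_lt_t i
  have h' : (I.t i : ℕ) < I.m + 1 := (I.t i).isLt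
  refine ⟨⟨I.s i, by omega⟩, ?_⟩
  simp only [path, Uses, Finset.mem_filter, Finset.mem_univ, true_and, Fin.le_def,
    Fin.val_castSucc, Fin.val_succ]
  omega

/-- The bottleneck capacity of task `i`: the least capacity of an edge that it uses. -/
def b (I : UFPP) (i : Fin I.n) : ℕ := (I.path i).inf' (I.path_nonempty i) I.u

/-- `b i - d i`, as an integer. It is negative if `i` alone exceeds its bottleneck capacity. -/
def l (I : UFPP) (i : Fin I.n) : ℤ := (I.b i : ℤ) - I.d i

def IsSmall (I : UFPP) (δ : ℚ) (i : Fin I.n) : Prop := (I.d i : ℚ) ≤ δ * I.b i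

def IsLarge (I : UFPP) (δ : ℚ) (i : Fin I.n) : Prop := ¬ I.IsSmall δ i

def profit (I : UFPP) (F : Finset (Fin I.n)) : ℕ := ∑ i ∈ F, I.w i

/-- On every edge, the tasks of `F` that use it have total demand at most its capacity. -/
def IsFeasible (I : UFPP) (F : Finset (Fin I.n)) : Prop :=
  ∀ e : Fin I.m, ∑ i ∈ F.filter (fun i => I.Uses i e), I.d i ≤ I.u e

/-- An axis-parallel rectangle with upper left corner `(x₁, y₁)` and lower right corner
`(x₂, y₂)`. -/
structure Rect where
  x₁ : ℤ
  y₁ : ℤ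
  x₂ : ℤ
  y₂ : ℤ

/-- Two rectangles are compatible if they do not overlap. -/
def Rect.Compatible (R R' : Rect) : Prop :=
  R.x₂ ≤ R'.x₁ ∨ R'.x₂ ≤ R.x₁ ∨ R.y₁ ≤ R'.y₂ ∨ R'.y₁ ≤ R.y₂

/-- The rectangle of task `i`: it spans the task's path, has height `d i`, and is drawn as high
as possible under the capacity profile. -/
def rect (I : UFPP) (i : Fin I.n) : Rect := ⟨(I.s i : ℕ), I.b i, (I.t i : ℕ), I.l i⟩

/-- Independent task sets: the rectangles lie in the region between the horizontal axis and the
capacity profile, and are pairwise compatible. -/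
def IsITS (I : UFPP) (F : Finset (Fin I.n)) : Prop :=
  (∀ i ∈ F, 0 ≤ I.l i) ∧
    ∀ i ∈ F, ∀ j ∈ F, i ≠ j → (I.rect i).Compatible (I.rect j)

/-- `F` is an independent task set of maximum profit. -/
def IsMaxITS (I : UFPP) (F : Finset (Fin I.n)) : Prop :=
  I.IsITS F ∧ ∀ F', I.IsITS F' → I.profit F' ≤ I.profit F

/-- An upper bound for the numbers of vertices and tasks and for all the numbers in the input. -/
def magnitude (I : UFPP) : ℕ :=
  I.n + I.m + (∑ e, I.u e) + (∑ i, I.d i) + (∑ i, I.w i) + 2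

end UFPP

/-! ### A word RAM with a unit-cost step count

Programs are written in a structured form (loops in place of jumps). A program is a finite text and
so mentions finitely many registers and finitely many arrays, each addressed by a number written in
the program; the index into an array is computed at run time (indirect addressing). -/

namespace WordRAM

/-- A memory: the contents of the registers and of the arrays, all of them natural numbers. -/
structure State where
  reg : ℕ → ℕ
  arr : ℕ → ℕ → ℕ

def State.setReg (σ : State) (x v : ℕ) : State :=
  { σ with reg := Function.update σ.reg x v }

def State.setArr (σ : State) (a i v : ℕ) : State :=
  { σ with arr := Function.update σ.arr a (Function.update (σ.arr a) i v) }

/-- The arithmetic instructions: addition, truncated subtraction, multiplication, and the two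
comparisons, which return `1` for true and `0` for false. -/
inductive Op where
  | plus | minus | times | less | equal

def Op.eval : Op → ℕ → ℕ → ℕ
  | .plus, a, b => a + b
  | .minus, a, b => a - b
  | .times, a, b => a * b
  | .less, a, b => if a < b then 1 else 0
  | .equal, a, b => if a = b then 1 else 0

/-- Expressions: constants, registers, array entries, and arithmetic. -/
inductive Expr where
  | const (c : ℕ)
  | reg (x : ℕ)
  | get (a : ℕ) (i : Expr)
  | op (o : Op) (e₁ e₂ : Expr)

def Expr.eval (σ : State) : Expr → ℕ
  | .const c => c
  | .reg x => σ.reg x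
  | .get a i => σ.arr a (i.eval σ)
  | .op o e₁ e₂ => o.eval (e₁.eval σ) (e₂.eval σ)

/-- Every constant, register access, array access and arithmetic operation takes one step. -/
def Expr.cost : Expr → ℕ
  | .const _ => 1
  | .reg _ => 1
  | .get _ i => i.cost + 1
  | .op _ e₁ e₂ => e₁.cost + e₂.cost + 1

/-- All the values that occur in the evaluation (array indices too) are words, that is, at most
`B`. -/
def Expr.Within (B : ℕ) (σ : State) : Expr → Prop
  | .const c => c ≤ B
  | .reg x => σ.reg x ≤ B
  | .get a i => i.Within B σ ∧ σ.arr a (i.eval σ) ≤ B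
  | .op o e₁ e₂ => e₁.Within B σ ∧ e₂.Within B σ ∧ o.eval (e₁.eval σ) (e₂.eval σ) ≤ B

/-- Programs. -/
inductive Prog where
  | skip
  | assign (x : ℕ) (e : Expr)
  | store (a : ℕ) (i e : Expr)
  | seq (p q : Prog)
  | cond (e : Expr) (p q : Prog)
  | loop (e : Expr) (p : Prog)

/-- `Exec B p σ T σ'`: on a machine whose words hold the numbers `0, …, B`, the program `p`, started
in the memory `σ`, halts after exactly `T` steps in the memory `σ'`, without ever computing a number
that does not fit into a word (there is no rule for a step that would overflow). The tests
of `cond` and `loop` succeed when the value is not zero. -/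
inductive Exec (B : ℕ) : Prog → State → ℕ → State → Prop where
  | skip (σ : State) : Exec B .skip σ 1 σ
  | assign (σ : State) (x : ℕ) (e : Expr) : e.Within B σ →
      Exec B (.assign x e) σ (e.cost + 1) (σ.setReg x (e.eval σ))
  | store (σ : State) (a : ℕ) (i e : Expr) : i.Within B σ → e.Within B σ →
      Exec B (.store a i e) σ (i.cost + e.cost + 1) (σ.setArr a (i.eval σ) (e.eval σ))
  | seq (p q : Prog) (σ σ₁ σ₂ : State) (T₁ T₂ : ℕ) : Exec B p σ T₁ σ₁ → Exec B q σ₁ T₂ σ₂ →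
      Exec B (.seq p q) σ (T₁ + T₂) σ₂
  | cond_true (e : Expr) (p q : Prog) (σ σ₁ : State) (T : ℕ) : e.Within B σ → e.eval σ ≠ 0 →
      Exec B p σ T σ₁ → Exec B (.cond e p q) σ (e.cost + 1 + T) σ₁
  | cond_false (e : Expr) (p q : Prog) (σ σ₁ : State) (T : ℕ) : e.Within B σ → e.eval σ = 0 →
      Exec B q σ T σ₁ → Exec B (.cond e p q) σ (e.cost + 1 + T) σ₁
  | loop_true (e : Expr) (p : Prog) (σ σ₁ σ₂ : State) (T₁ T₂ : ℕ) : e.Within B σ →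
      e.eval σ ≠ 0 → Exec B p σ T₁ σ₁ → Exec B (.loop e p) σ₁ T₂ σ₂ →
      Exec B (.loop e p) σ (e.cost + 1 + T₁ + T₂) σ₂
  | loop_false (e : Expr) (p : Prog) (σ : State) : e.Within B σ → e.eval σ = 0 →
      Exec B (.loop e p) σ (e.cost + 1) σ

/-- The memory cells `0, …, k - 1` hold the values of `f`, and all further ones hold `0`. -/
def cells {k : ℕ} (f : Fin k → ℕ) (j : ℕ) : ℕ := if h : j < k then f ⟨j, h⟩ else 0

end WordRAM

namespace UFPP

/-- The memory in which a program is started on the instance `I`: registers `0` and `1` hold the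
number of tasks and the number of edges, arrays `0, …, 4` hold the capacities, start
vertices, end vertices, demands and profits, and everything else is `0`. -/
def input (I : UFPP) : WordRAM.State where
  reg
    | 0 => I.n
    | 1 => I.m
    | _ => 0
  arr
    | 0 => WordRAM.cells I.u
    | 1 => WordRAM.cells (fun i => (I.s i : ℕ))
    | 2 => WordRAM.cells (fun i => (I.t i : ℕ))
    | 3 => WordRAM.cells I.d
    | 4 => WordRAM.cells I.w
    | _ => fun _ => 0

/-- The task set that a program returns: its indicator vector is read off from array `5`. -/
def output (I : UFPP) (σ : WordRAM.State) : Finset (Fin I.n) :=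
  Finset.univ.filter (fun i => σ.arr 5 i ≠ 0)

end UFPP

/-!
Two tasks conflict if their rectangles overlap. Every task `i` has a bottleneck edge, one of capacity
`b i`.

*Partition into independent task sets.* Let `F` be a feasible set of `1/k`-large tasks. The tasks that
use the bottleneck edge of `i` and meet `i` vertically reach above the height `l i`, hence have demands
larger than `l i / k`, while these demands sum up to at most `l i`: there are fewer than `k` of them
(`card_lt_of_uses_bottleneck`). Greedy colouring in the order of the bottleneck capacities gives `k`
classes in which no task conflicts with a task that uses its bottleneck edge. In such a class the
conflict graph is a forest (`exists_two_coloring`): the task with the least bottleneck capacity is the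
only one on its bottleneck edge, and it conflicts with at most one task on either side of this edge. So
two colours suffice for each class, and `2 * k` colours for `F` (`exists_partition_isITS`). Conversely,
the rectangles of an independent task set are stacked above each edge, so that the set is feasible
(`IsITS.isFeasible`); hence an independent task set of maximum profit is a `2 * k`-approximation.

*Independent task sets of maximum profit.* Let `i` and `k` be two tasks, or the ends of the path, and
consider the independent sets in the region between `i` and `k` above their lower ends
(`Boxes.Between`). Let `q` be the task of such a set with the lowest lower end. As the rectangle of `q`
touches the capacity profile at its bottleneck edge, all other tasks of the set lie between `i` and `q`
or between `q` and `k` (`Boxes.Indep.exists_split`), and any two independent sets in these two regions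
can be combined (`Boxes.Indep.union`). This gives a recursion over pairs of tasks. The program
`WordRAM.rounds` runs through all pairs `n` times and improves the value of each pair by means of the
present values of the other ones, in time `O(n)` for each pair; after `r` rounds, the values are optimal
for all pairs with at most `r` tasks in between (`WordRAM.Known`). Together with each value, the program
keeps the indicator vector of a set that attains it. All this takes time `O(n ^ 4)`.

*Bottleneck edges.* To find them in time `O(n ^ 2 + m)`, the end vertices of all tasks are marked, and
one sweep over the path finds the cheapest edge between any two consecutive marked vertices. A
bottleneck edge of a task is among those that follow the marked vertices of its path
(`WordRAM.isCheapest_of_leaders`).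
-/

namespace UFPP

variable {I : UFPP} {i j : Fin I.n} {e : Fin I.m} {k : ℕ}

/-! ### Bottleneck edges and the geometry of the rectangles -/

theorem uses_iff : I.Uses i e ↔ (I.s i : ℕ) ≤ e ∧ (e : ℕ) + 1 ≤ I.t i := by
  simp [Uses, Fin.le_def]

theorem b_le_of_uses (h : I.Uses i e) : I.b i ≤ I.u e :=
  Finset.inf'_le _ (by simp [path, h])

/-- The rectangles of `i` and `j` span overlapping vertical intervals. -/
def Meets (I : UFPP) (i j : Fin I.n) : Prop := I.l i < I.b j ∧ I.l j < I.b i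

theorem Meets.symm (h : I.Meets i j) : I.Meets j i := ⟨h.2, h.1⟩

theorem compatible_iff : (I.rect i).Compatible (I.rect j) ↔
    (I.t i : ℕ) ≤ I.s j ∨ (I.t j : ℕ) ≤ I.s i ∨ ¬ I.Meets i j := by
  simp only [Rect.Compatible, rect, Meets, Nat.cast_le, not_and_or, not_lt]
  tauto

theorem Rect.Compatible.symm {R R' : Rect} (h : R.Compatible R') : R'.Compatible R := by
  unfold Rect.Compatible at *; tauto

theorem isLarge_iff (hk : 2 ≤ k) : I.IsLarge (1 / (k : ℚ)) i ↔ I.b i < k * I.d i := by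
  have hk' : (0 : ℚ) < k := by positivity
  rw [IsLarge, IsSmall, not_le, one_div, inv_mul_lt_iff₀ hk']
  exact_mod_cast Iff.rfl

theorem d_pos_of_isLarge (hk : 2 ≤ k) (h : I.IsLarge (1 / (k : ℚ)) i) : 0 < I.d i := by
  rw [isLarge_iff hk] at h
  exact Nat.pos_of_ne_zero fun h0 => by simp [h0] at h

/-- `e` chooses for each task one of its bottleneck edges. -/
structure IsBottleneck (I : UFPP) (e : Fin I.n → Fin I.m) : Prop where
  uses : ∀ i, I.Uses i (e i)
  u_eq : ∀ i, I.u (e i) = I.b i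

/-- The bottleneck edges can be chosen as the least ones in a common linear order of all edges, by
capacity and then from left to right. -/
theorem exists_bottleneck (I : UFPP) : ∃ e : Fin I.n → Fin I.m, I.IsBottleneck e ∧
    ∀ i j, I.Uses j (e i) → toLex (I.u (e j), e j) ≤ toLex (I.u (e i), e i) := by
  choose e he hmin using fun i =>
    Finset.exists_min_image (I.path i) (fun e => toLex (I.u e, e)) (I.path_nonempty i)
  have hu : ∀ i, I.Uses i (e i) := fun i => by simpa [path] using he i
  refine ⟨e, ⟨hu, fun i => le_antisymm ?_ (b_le_of_uses (hu i))⟩, fun i j hj => ?_⟩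
  · refine Finset.le_inf' _ _ fun x hx => ?_
    have := hmin i x hx
    rw [Prod.Lex.toLex_le_toLex] at this
    rcases this with h | h
    · exact h.le
    · exact h.1.le
  · exact hmin j (e i) (by simpa [path] using hj)

theorem d_le_b_of_isFeasible {F : Finset (Fin I.n)} (hF : I.IsFeasible F) (hi : i ∈ F) :
    I.d i ≤ I.b i := by
  obtain ⟨e, he, -⟩ := I.exists_bottleneck
  rw [← he.u_eq i]
  exact (Finset.single_le_sum (f := I.d) (fun _ _ => Nat.zero_le _)
    (by simp [hi, he.uses i])).trans (hF (e i))

/-! ### Colouring a feasible set of large tasks -/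

/-- Greedy colouring in the order of `r`. -/
theorem exists_coloring_of_rank {α β : Type*} [DecidableEq α] [LinearOrder β] (r : α → β)
    (R : α → α → Prop) (hR : ∀ i j, R i j → R j i) (F : Finset α)
    (h : ∀ i ∈ F, ∀ G ⊆ F, (∀ j ∈ G, j ≠ i ∧ r j ≤ r i ∧ R i j) → G.card < k) (hk : 0 < k) :
    ∃ c : α → Fin k, ∀ i ∈ F, ∀ j ∈ F, i ≠ j → R i j → c i ≠ c j := by
  classical
  induction F using Finset.induction_on_max_value r with
  | empty => exact ⟨fun _ => ⟨0, hk⟩, by simp⟩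
  | insert a s has hmax ih =>
    obtain ⟨c, hc⟩ := ih fun i hi G hG =>
      h i (Finset.mem_insert_of_mem hi) G (hG.trans (Finset.subset_insert a s))
    have hlt := h a (Finset.mem_insert_self a s) (s.filter (fun j => R a j))
      ((Finset.filter_subset _ _).trans (Finset.subset_insert a s)) (by
        intro j hj
        rw [Finset.mem_filter] at hj
        exact ⟨fun h => has (h ▸ hj.1), hmax j hj.1, hj.2⟩)
    obtain ⟨x, hx⟩ : ∃ x : Fin k, x ∉ (s.filter (fun j => R a j)).image c := by
      by_contra! hall
      have := Finset.card_le_card (fun x _ => hall x : Finset.univ ⊆ _)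
      rw [Finset.card_univ, Fintype.card_fin] at this
      exact absurd (this.trans Finset.card_image_le) (by omega)
    have hx' : ∀ j ∈ s, R a j → c j ≠ x := fun j hj hr hcx =>
      hx (Finset.mem_image.2 ⟨j, by simp [hj, hr], hcx⟩)
    refine ⟨Function.update c a x, fun i hi j hj hij hr => ?_⟩
    rw [Finset.mem_insert] at hi hj
    rcases hi with rfl | hi <;> rcases hj with rfl | hj
    · exact absurd rfl hij
    · rw [Function.update_self, Function.update_of_ne hij.symm]
      exact (hx' j hj hr).symm
    · rw [Function.update_self, Function.update_of_ne hij]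
      exact hx' i hi (hR _ _ hr)
    · rw [Function.update_of_ne (by rintro rfl; exact has hi),
        Function.update_of_ne (by rintro rfl; exact has hj)]
      exact hc i hi j hj hij hr

/-- All these tasks use the bottleneck edge of `i`, so together with `i` their demands sum up to at
most `b i`, while each single demand exceeds `l i / k`. -/
theorem card_lt_of_uses_bottleneck (hk : 2 ≤ k) {F : Finset (Fin I.n)} (hF : I.IsFeasible F)
    (hL : ∀ i ∈ F, I.IsLarge (1 / (k : ℚ)) i) {E : Fin I.n → Fin I.m} (hE : I.IsBottleneck E)
    (hi : i ∈ F) {G : Finset (Fin I.n)} (hG : G ⊆ F)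
    (h : ∀ j ∈ G, j ≠ i ∧ I.Uses j (E i) ∧ I.l i < I.b j) : G.card < k := by
  have hd : I.d i ≤ I.b i := d_le_b_of_isFeasible hF hi
  have hiG : i ∉ G := fun hi' => (h i hi').1 rfl
  have h1 : I.d i + ∑ j ∈ G, I.d j ≤ I.b i := by
    rw [← Finset.sum_insert hiG, ← hE.u_eq i]
    refine (Finset.sum_le_sum_of_subset ?_).trans (hF (E i))
    intro j hj
    rw [Finset.mem_insert] at hj
    rcases hj with rfl | hj
    · simp [hi, hE.uses j]
    · simp [hG hj, (h j hj).2.1]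
  have h2 : G.card * (I.b i - I.d i + 1) ≤ k * ∑ j ∈ G, I.d j := by
    rw [Finset.mul_sum, ← smul_eq_mul, ← Finset.sum_const]
    refine Finset.sum_le_sum fun j hj => ?_
    have h3 := (isLarge_iff hk).1 (hL j (hG hj))
    have h4 := (h j hj).2.2
    unfold l at h4
    omega
  have h5 : k * ∑ j ∈ G, I.d j ≤ k * (I.b i - I.d i) := Nat.mul_le_mul_left _ (by omega)
  by_contra! h6
  have h7 := Nat.mul_le_mul_right (I.b i - I.d i + 1) h6
  have h8 := h7.trans (h2.trans h5)
  rw [Nat.mul_add] at h8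
  omega

/-- Suppose that `i` has the least bottleneck capacity in `C`, and that no task of `C` whose path
contains the bottleneck edge of another one meets it. Then on the left of its bottleneck edge, `i` is
incompatible with at most one task: two such tasks would both reach from the left over the start
vertex of `i` and both contain the height `b i`. -/
theorem left_conflict_unique {E : Fin I.n → Fin I.m} (hE : I.IsBottleneck E)
    {C : Finset (Fin I.n)}
    (hC : ∀ i ∈ C, ∀ j ∈ C, i ≠ j → I.Uses j (E i) → ¬ I.Meets i j)
    (hi : i ∈ C) (hmin : ∀ j ∈ C, I.b i ≤ I.b j) {j j' : Fin I.n} (hj : j ∈ C) (hj' : j' ∈ C)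
    (hl : (I.t j : ℕ) ≤ E i) (hl' : (I.t j' : ℕ) ≤ E i)
    (hc : ¬ (I.rect i).Compatible (I.rect j)) (hc' : ¬ (I.rect i).Compatible (I.rect j')) :
    j = j' := by
  by_contra hne
  wlog hle : (E j : ℕ) ≤ E j' generalizing j j'
  · exact this hj' hj hl' hl hc' hc (Ne.symm hne) (by omega)
  simp only [compatible_iff, not_or, not_not, not_le] at hc hc'
  have hu := uses_iff.1 (hE.uses i)
  have hu1 := uses_iff.1 (hE.uses j)
  have hu2 := uses_iff.1 (hE.uses j')
  have hm := hmin j hj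
  have hm' := hmin j' hj'
  have key : ¬ I.Uses i (E j') := fun h => hC j' hj' i hi
    (by rintro rfl; omega) h hc'.2.2.symm
  rw [uses_iff] at key
  refine hC j' hj' j hj (Ne.symm hne) (uses_iff.2 (by omega)) ?_
  have h1 := hc.2.2
  have h2 := hc'.2.2
  unfold Meets at *
  omega

/-- The mirror image of `left_conflict_unique`. -/
theorem right_conflict_unique {E : Fin I.n → Fin I.m} (hE : I.IsBottleneck E)
    {C : Finset (Fin I.n)}
    (hC : ∀ i ∈ C, ∀ j ∈ C, i ≠ j → I.Uses j (E i) → ¬ I.Meets i j)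
    (hi : i ∈ C) (hmin : ∀ j ∈ C, I.b i ≤ I.b j) {j j' : Fin I.n} (hj : j ∈ C) (hj' : j' ∈ C)
    (hl : (E i : ℕ) < I.s j) (hl' : (E i : ℕ) < I.s j')
    (hc : ¬ (I.rect i).Compatible (I.rect j)) (hc' : ¬ (I.rect i).Compatible (I.rect j')) :
    j = j' := by
  by_contra hne
  wlog hle : (E j' : ℕ) ≤ E j generalizing j j'
  · exact this hj' hj hl' hl hc' hc (Ne.symm hne) (by omega)
  simp only [compatible_iff, not_or, not_not, not_le] at hc hc'
  have hu := uses_iff.1 (hE.uses i)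
  have hu1 := uses_iff.1 (hE.uses j)
  have hu2 := uses_iff.1 (hE.uses j')
  have hm := hmin j hj
  have hm' := hmin j' hj'
  have key : ¬ I.Uses i (E j') := fun h => hC j' hj' i hi
    (by rintro rfl; omega) h hc'.2.2.symm
  rw [uses_iff] at key
  refine hC j' hj' j hj (Ne.symm hne) (uses_iff.2 (by omega)) ?_
  have h1 := hc.2.2
  have h2 := hc'.2.2
  unfold Meets at *
  omega

/-- A two-colouring may be changed so that a given vertex conflicts with no vertex of the colour
`true`, if it conflicts with at most one vertex. -/
theorem exists_flip {α : Type*} (P : α → Prop) (hP : ∀ j j', P j → P j' → j = j') (β : α → Bool) :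
    ∃ β' : α → Bool, (∀ j j', β' j = β' j' ↔ β j = β j') ∧ ∀ j, P j → β' j = false := by
  by_cases h : ∃ j, P j
  · obtain ⟨j, hj⟩ := h
    refine ⟨fun x => xor (β x) (β j), fun x y => by simp, fun x hx => ?_⟩
    rw [hP x j hx hj]
    simp
  · exact ⟨β, fun _ _ => Iff.rfl, fun j hj => (h ⟨j, hj⟩).elim⟩

/-- If no task of `C` whose path contains the bottleneck edge of another one meets it, then the
incompatibility graph of `C` is a forest, and hence bipartite: the task `i` with the least bottleneck
capacity is the only one that uses its bottleneck edge, and it is incompatible with at most one task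
on each side of this edge. -/
theorem exists_two_coloring {E : Fin I.n → Fin I.m} (hE : I.IsBottleneck E)
    (C : Finset (Fin I.n)) (hd : ∀ i ∈ C, 0 < I.d i)
    (hC : ∀ i ∈ C, ∀ j ∈ C, i ≠ j → I.Uses j (E i) → ¬ I.Meets i j) :
    ∃ β : Fin I.n → Bool, ∀ i ∈ C, ∀ j ∈ C, i ≠ j → β i = β j →
      (I.rect i).Compatible (I.rect j) := by
  classical
  induction C using Finset.strongInduction with
  | H C ih =>
  rcases C.eq_empty_or_nonempty with rfl | hne
  · exact ⟨fun _ => true, by simp⟩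
  obtain ⟨i, hi, hmin⟩ := Finset.exists_min_image C I.b hne
  have sub : ∀ p : Fin I.n → Prop, ¬ p i → ∃ β : Fin I.n → Bool,
      ∀ x ∈ C, ∀ y ∈ C, p x → p y → x ≠ y → β x = β y →
        (I.rect x).Compatible (I.rect y) := by
    intro p hp
    obtain ⟨β, hβ⟩ := ih (C.filter p) (Finset.filter_ssubset.2 ⟨i, hi, hp⟩)
      (fun x hx => hd x (Finset.mem_filter.1 hx).1)
      (fun x hx y hy => hC x (Finset.mem_filter.1 hx).1 y (Finset.mem_filter.1 hy).1)
    exact ⟨β, fun x hx y hy px py =>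
      hβ x (Finset.mem_filter.2 ⟨hx, px⟩) y (Finset.mem_filter.2 ⟨hy, py⟩)⟩
  have hui := uses_iff.1 (hE.uses i)
  obtain ⟨βl, hβl⟩ := sub (fun j => (I.t j : ℕ) ≤ E i) (by omega)
  obtain ⟨βr, hβr⟩ := sub (fun j => (E i : ℕ) < I.s j) (by omega)
  obtain ⟨γl, hγl, hγl'⟩ := exists_flip (fun j => j ∈ C ∧ (I.t j : ℕ) ≤ E i ∧
    ¬ (I.rect i).Compatible (I.rect j)) (fun j j' h h' =>
      left_conflict_unique hE hC hi hmin h.1 h'.1 h.2.1 h'.2.1 h.2.2 h'.2.2) βl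
  obtain ⟨γr, hγr, hγr'⟩ := exists_flip (fun j => j ∈ C ∧ (E i : ℕ) < I.s j ∧
    ¬ (I.rect i).Compatible (I.rect j)) (fun j j' h h' =>
      right_conflict_unique hE hC hi hmin h.1 h'.1 h.2.1 h'.2.1 h.2.2 h'.2.2) βr
  have hside : ∀ j ∈ C, j ≠ i → (I.t j : ℕ) ≤ E i ∨ (E i : ℕ) < I.s j := by
    intro j hj hji
    by_contra! hcon
    have hu : I.Uses j (E i) := uses_iff.2 (by omega)
    have h1 := b_le_of_uses hu
    rw [hE.u_eq] at h1
    have h2 := hmin j hj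
    have h3 := hd i hi
    have h4 := hd j hj
    refine hC i hi j hj hji.symm hu ?_
    unfold Meets l
    omega
  -- the colour of `i` is `true`; the two sides are coloured so that its neighbours get `false`
  refine ⟨fun j => if j = i then true else if (I.t j : ℕ) ≤ E i then γl j else γr j, ?_⟩
  have hfst : ∀ j ∈ C, j ≠ i →
      true = (if j = i then true else if (I.t j : ℕ) ≤ E i then γl j else γr j) →
      (I.rect i).Compatible (I.rect j) := by
    intro j hj hji h
    by_contra hcon
    rw [if_neg hji] at h
    split_ifs at h with ht
    · rw [hγl' j ⟨hj, ht, hcon⟩] at h; cases h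
    · rw [hγr' j ⟨hj, (hside j hj hji).resolve_left ht, hcon⟩] at h; cases h
  intro x hx y hy hxy h
  by_cases hxi : x = i
  · subst hxi
    exact hfst y hy hxy.symm (by simpa using h)
  by_cases hyi : y = i
  · subst hyi
    exact (hfst x hx hxy (by simpa using h.symm)).symm
  simp only [hxi, hyi, if_false] at h
  have hsx := hside x hx hxi
  have hsy := hside y hy hyi
  by_cases htx : (I.t x : ℕ) ≤ E i <;> by_cases hty : (I.t y : ℕ) ≤ E i
  · rw [if_pos htx, if_pos hty, hγl] at h
    exact hβl x hx y hy htx hty hxy h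
  · exact compatible_iff.2 (by omega)
  · exact compatible_iff.2 (by omega)
  · rw [if_neg htx, if_neg hty, hγr] at h
    exact hβr x hx y hy (hsx.resolve_left htx) (hsy.resolve_left hty) hxy h

/-- The colour of a task is a pair: the first component, out of `k`, separates the tasks that meet
and of which one uses the bottleneck edge of the other; the second one, out of two, resolves the
remaining conflicts. -/
theorem exists_partition_isITS (hk : 2 ≤ k) {F : Finset (Fin I.n)} (hF : I.IsFeasible F)
    (hL : ∀ i ∈ F, I.IsLarge (1 / (k : ℚ)) i) :
    ∃ α : Fin I.n → Fin (2 * k), ∀ a, I.IsITS (F.filter (fun i => α i = a)) := by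
  classical
  obtain ⟨E, hE, hlex⟩ := I.exists_bottleneck
  obtain ⟨c, hc⟩ := exists_coloring_of_rank (k := k) (fun i => toLex (I.u (E i), E i))
    (fun i j => I.Meets i j ∧ (I.Uses j (E i) ∨ I.Uses i (E j)))
    (fun i j h => ⟨h.1.symm, h.2.symm⟩) F (by
      refine fun i hi G hG h => card_lt_of_uses_bottleneck hk hF hL hE hi hG fun j hj => ?_
      obtain ⟨hji, hr, hm, hu⟩ := h j hj
      refine ⟨hji, hu.elim id fun hu => ?_, hm.1⟩
      have heq := le_antisymm (hlex j i hu) hr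
      have : E i = E j := (Prod.ext_iff.1 (toLex.injective heq)).2
      rw [this]
      exact hE.uses j) (by omega)
  choose β hβ using fun a => exists_two_coloring hE (F.filter (fun i => c i = a))
    (fun i hi => d_pos_of_isLarge hk (hL i (Finset.mem_filter.1 hi).1))
    (by
      intro i hi j hj hij hu hm
      rw [Finset.mem_filter] at hi hj
      exact hc i hi.1 j hj.1 hij ⟨hm, Or.inl hu⟩ (hi.2.trans hj.2.symm))
  refine ⟨fun i => finProdFinEquiv (if β (c i) i then 1 else 0, c i), fun a => ⟨?_, ?_⟩⟩
  · intro i hi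
    have := d_le_b_of_isFeasible hF (Finset.mem_filter.1 hi).1
    unfold l
    omega
  · intro i hi j hj hij
    rw [Finset.mem_filter] at hi hj
    have h := finProdFinEquiv.injective (hi.2.trans hj.2.symm)
    rw [Prod.mk.injEq] at h
    refine hβ (c i) i (by simp [hi.1]) j (by simp [hj.1, h.2]) hij ?_
    have h1 := h.1
    rw [← h.2] at h1
    cases h2 : β (c i) i <;> cases h3 : β (c i) j <;> simp_all

/-! ### Independent task sets of maximum profit -/

/-- On each edge, the rectangles of the tasks that use it are stacked between height `0` and the
capacity. -/
theorem IsITS.isFeasible {F : Finset (Fin I.n)} (h : I.IsITS F) : I.IsFeasible F := by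
  classical
  intro e
  have hdisj : ∀ i ∈ F.filter (fun i => I.Uses i e), ∀ j ∈ F.filter (fun i => I.Uses i e), i ≠ j →
      Disjoint (Finset.Ico (I.l i) (I.b i)) (Finset.Ico (I.l j) (I.b j)) := by
    intro i hi j hj hij
    rw [Finset.mem_filter] at hi hj
    have hc := compatible_iff.1 (h.2 i hi.1 j hj.1 hij)
    have h1 := uses_iff.1 hi.2
    have h2 := uses_iff.1 hj.2
    rw [Finset.disjoint_left]
    intro x hx hx'
    rw [Finset.mem_Ico] at hx hx'
    unfold Meets at hc
    omega
  have hsub : (F.filter (fun i => I.Uses i e)).biUnion (fun i => Finset.Ico (I.l i) (I.b i)) ⊆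
      Finset.Ico (0 : ℤ) (I.u e) := by
    intro x hx
    rw [Finset.mem_biUnion] at hx
    obtain ⟨i, hi, hx⟩ := hx
    rw [Finset.mem_filter] at hi
    rw [Finset.mem_Ico] at hx ⊢
    have := h.1 i hi.1
    have := b_le_of_uses hi.2
    omega
  have hcard := Finset.card_le_card hsub
  rw [Finset.card_biUnion hdisj] at hcard
  simpa [l] using hcard

theorem profit_le_of_isMaxITS (hk : 2 ≤ k) (hL : ∀ i, I.IsLarge (1 / (k : ℚ)) i)
    {S F : Finset (Fin I.n)} (hS : I.IsMaxITS S) (hF : I.IsFeasible F) :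
    1 / (2 * (k : ℚ)) * (I.profit F : ℚ) ≤ (I.profit S : ℚ) := by
  obtain ⟨α, hα⟩ := exists_partition_isITS hk hF (fun i _ => hL i)
  have h : I.profit F ≤ 2 * k * I.profit S := by
    calc I.profit F = ∑ a, I.profit (F.filter (fun i => α i = a)) :=
          (Finset.sum_fiberwise F α I.w).symm
      _ ≤ ∑ _a : Fin (2 * k), I.profit S := Finset.sum_le_sum fun a _ => hS.2 _ (hα a)
      _ = 2 * k * I.profit S := by simp
  have hk' : (0 : ℚ) < 2 * k := by positivity
  rw [one_div, inv_mul_le_iff₀ hk']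
  exact_mod_cast h

end UFPP

namespace WordRAM

/-! ### Reasoning about word-RAM programs -/

instance (n : ℕ) : OfNat Expr n := ⟨.const n⟩
instance : Add Expr := ⟨.op .plus⟩
instance : Sub Expr := ⟨.op .minus⟩
instance : Mul Expr := ⟨.op .times⟩

/-- The test `a < b`. -/
def Expr.lt (a b : Expr) : Expr := .op .less a b

/-- The test `a ≤ b`, as `a < b + 1`. -/
def Expr.le (a b : Expr) : Expr := .op .less a (b + 1)

section eval
variable (σ : State) (a b : Expr)

@[simp] theorem Expr.eval_ofNat (n : ℕ) : Expr.eval σ (no_index (OfNat.ofNat n) : Expr) = n := rfl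
@[simp] theorem Expr.eval_add : (a + b).eval σ = a.eval σ + b.eval σ := rfl
@[simp] theorem Expr.eval_sub : (a - b).eval σ = a.eval σ - b.eval σ := rfl
@[simp] theorem Expr.eval_mul : (a * b).eval σ = a.eval σ * b.eval σ := rfl
@[simp] theorem Expr.eval_lt : (a.lt b).eval σ = if a.eval σ < b.eval σ then 1 else 0 := rfl
@[simp] theorem Expr.eval_le : (a.le b).eval σ = if a.eval σ ≤ b.eval σ then 1 else 0 := by
  simp [Expr.le, Expr.eval, Op.eval]
@[simp] theorem Expr.eval_reg (x : ℕ) : (Expr.reg x).eval σ = σ.reg x := rfl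
@[simp] theorem Expr.eval_get (x : ℕ) : (Expr.get x a).eval σ = σ.arr x (a.eval σ) := rfl

end eval

@[simp] theorem State.setReg_reg (σ : State) (x v y : ℕ) :
    (σ.setReg x v).reg y = if y = x then v else σ.reg y := Function.update_apply _ _ _ _

@[simp] theorem State.setReg_arr (σ : State) (x v : ℕ) : (σ.setReg x v).arr = σ.arr := rfl

@[simp] theorem State.setArr_reg (σ : State) (a i v : ℕ) : (σ.setArr a i v).reg = σ.reg := rfl

@[simp] theorem State.setArr_arr (σ : State) (a i v b : ℕ) :
    (σ.setArr a i v).arr b = if b = a then Function.update (σ.arr a) i v else σ.arr b :=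
  Function.update_apply _ _ _ _

/-- All registers and all array entries are at most `M`. -/
def State.Bdd (M : ℕ) (σ : State) : Prop := (∀ x, σ.reg x ≤ M) ∧ ∀ a i, σ.arr a i ≤ M

theorem State.Bdd.setReg {M : ℕ} {σ : State} (h : σ.Bdd M) {x v : ℕ} (hv : v ≤ M) :
    (σ.setReg x v).Bdd M := by
  refine ⟨fun y => ?_, h.2⟩
  rw [State.setReg_reg]
  split_ifs
  exacts [hv, h.1 y]

theorem State.Bdd.setArr {M : ℕ} {σ : State} (h : σ.Bdd M) {a i v : ℕ} (hv : v ≤ M) :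
    (σ.setArr a i v).Bdd M := by
  refine ⟨h.1, fun b j => ?_⟩
  rw [State.setArr_arr]
  split_ifs
  · rw [Function.update_apply]
    split_ifs
    exacts [hv, h.2 a j]
  · exact h.2 b j

/-- An exponent such that in memories with entries at most `M ≥ 2`, all values that occur in the
evaluation of the expression are at most `M` to this exponent. -/
def Expr.lev : Expr → ℕ
  | .const c => c
  | .reg _ => 1
  | .get _ i => max i.lev 1
  | .op .plus a b => max a.lev b.lev + 1
  | .op .times a b => a.lev + b.lev
  | .op _ a b => max a.lev b.lev

theorem Expr.eval_le_pow_lev {M : ℕ} (hM : 2 ≤ M) {σ : State} (hσ : σ.Bdd M) (e : Expr) :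
    e.eval σ ≤ M ^ e.lev := by
  have hM1 : 1 ≤ M := by omega
  induction e with
  | const c => exact (Nat.lt_pow_self (by omega)).le
  | reg x => simpa [lev] using hσ.1 x
  | get a i _ =>
    exact (hσ.2 a _).trans ((pow_one M).ge.trans (Nat.pow_le_pow_right hM1 (le_max_right _ _)))
  | op o a b iha ihb =>
    have ha := iha.trans (Nat.pow_le_pow_right hM1 (le_max_left a.lev b.lev))
    have hb := ihb.trans (Nat.pow_le_pow_right hM1 (le_max_right a.lev b.lev))
    have hp : 1 ≤ M ^ max a.lev b.lev := Nat.one_le_pow _ _ hM1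
    cases o with
    | plus =>
      calc a.eval σ + b.eval σ ≤ M ^ max a.lev b.lev * 2 := by omega
        _ ≤ M ^ (max a.lev b.lev + 1) := by rw [pow_succ]; exact Nat.mul_le_mul_left _ hM
    | minus => exact (Nat.sub_le _ _).trans ha
    | times =>
      change a.eval σ * b.eval σ ≤ M ^ (a.lev + b.lev)
      rw [pow_add]
      exact Nat.mul_le_mul iha ihb
    | less => simp only [eval, Op.eval, lev]; split_ifs <;> omega
    | equal => simp only [eval, Op.eval, lev]; split_ifs <;> omega

theorem Expr.within_of_lev {M D : ℕ} (hM : 2 ≤ M) {σ : State} (hσ : σ.Bdd M) (e : Expr)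
    (h : e.lev ≤ D) : e.Within (M ^ D) σ := by
  have hM1 : 1 ≤ M := by omega
  have hpow : ∀ e : Expr, e.lev ≤ D → e.eval σ ≤ M ^ D := fun e h =>
    (e.eval_le_pow_lev hM hσ).trans (Nat.pow_le_pow_right hM1 h)
  induction e with
  | const c => exact hpow (.const c) h
  | reg x => exact hpow (.reg x) h
  | get a i ih =>
    exact ⟨ih ((le_max_left _ _).trans h), hpow (.get a i) h⟩
  | op o a b iha ihb =>
    have hab : a.lev ≤ (Expr.op o a b).lev ∧ b.lev ≤ (Expr.op o a b).lev := by
      cases o <;> simp only [lev] <;> omega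
    exact ⟨iha (hab.1.trans h), ihb (hab.2.trans h), hpow (.op o a b) h⟩

/-- The largest `Expr.lev` of an expression of the program. -/
def Prog.lev : Prog → ℕ
  | .skip => 0
  | .assign _ e => e.lev
  | .store _ i e => max i.lev e.lev
  | .seq p q => max p.lev q.lev
  | .cond e p q => max e.lev (max p.lev q.lev)
  | .loop e p => max e.lev p.lev

/-- The registers that a program may write to. -/
def Prog.modR : Prog → ℕ → Bool
  | .skip, _ => false
  | .assign x _, y => decide (y = x)
  | .store _ _ _, _ => false
  | .seq p q, y => p.modR y || q.modR y
  | .cond _ p q, y => p.modR y || q.modR y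
  | .loop _ p, y => p.modR y

/-- The arrays that a program may write to. -/
def Prog.modA : Prog → ℕ → Bool
  | .skip, _ => false
  | .assign _ _, _ => false
  | .store a _ _, b => decide (b = a)
  | .seq p q, b => p.modA b || q.modA b
  | .cond _ p q, b => p.modA b || q.modA b
  | .loop _ p, b => p.modA b

/-- The memories `σ` and `σ'` differ only in places that `p` may write to. -/
def Frame (p : Prog) (σ σ' : State) : Prop :=
  (∀ x, p.modR x = false → σ'.reg x = σ.reg x) ∧ ∀ a, p.modA a = false → σ'.arr a = σ.arr a

theorem Exec.frame {B : ℕ} {p : Prog} {σ σ' : State} {T : ℕ} (h : Exec B p σ T σ') :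
    Frame p σ σ' := by
  induction h with
  | skip | loop_false => exact ⟨fun _ _ => rfl, fun _ _ => rfl⟩
  | assign σ x e _ =>
    exact ⟨fun y hy => by simp [Prog.modR] at hy; simp [hy], fun _ _ => rfl⟩
  | store σ a i e _ _ =>
    exact ⟨fun _ _ => rfl, fun y hy => by simp [Prog.modA] at hy; simp [hy]⟩
  | seq p q σ σ₁ σ₂ T₁ T₂ _ _ ih₁ ih₂ =>
    refine ⟨fun y hy => ?_, fun y hy => ?_⟩
    · simp only [Prog.modR, Bool.or_eq_false_iff] at hy
      rw [ih₂.1 y hy.2, ih₁.1 y hy.1]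
    · simp only [Prog.modA, Bool.or_eq_false_iff] at hy
      rw [ih₂.2 y hy.2, ih₁.2 y hy.1]
  | cond_true e p q σ σ₁ T _ _ _ ih =>
    refine ⟨fun y hy => ?_, fun y hy => ?_⟩
    · simp only [Prog.modR, Bool.or_eq_false_iff] at hy
      exact ih.1 y hy.1
    · simp only [Prog.modA, Bool.or_eq_false_iff] at hy
      exact ih.2 y hy.1
  | cond_false e p q σ σ₁ T _ _ _ ih =>
    refine ⟨fun y hy => ?_, fun y hy => ?_⟩
    · simp only [Prog.modR, Bool.or_eq_false_iff] at hy
      exact ih.1 y hy.2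
    · simp only [Prog.modA, Bool.or_eq_false_iff] at hy
      exact ih.2 y hy.2
  | loop_true e p σ σ₁ σ₂ T₁ T₂ _ _ _ _ ih₁ ih₂ =>
    exact ⟨fun y hy => (ih₂.1 y hy).trans (ih₁.1 y hy),
      fun y hy => (ih₂.2 y hy).trans (ih₁.2 y hy)⟩

/-- Total correctness with a time bound: if the entries of `σ` are at most `M`, then `p` halts on
`σ` within `T` steps, without computing numbers beyond `M ^ D`, in a memory with entries at most `M`
that satisfies `Q`. -/
def Run (M D : ℕ) (p : Prog) (σ : State) (T : ℕ) (Q : State → Prop) : Prop :=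
  σ.Bdd M → ∃ T' σ', T' ≤ T ∧ Exec (M ^ D) p σ T' σ' ∧ σ'.Bdd M ∧ Q σ'

variable {M D : ℕ} {p q : Prog} {σ : State} {T T₁ T₂ : ℕ} {Q Q' : State → Prop}

/-- The rule of consequence, in which `σ'` may be assumed to agree with `σ` wherever `p` does not write. -/
theorem Run.mono (h : Run M D p σ T₁ Q) (hT : T₁ ≤ T₂)
    (hQ : ∀ σ', Frame p σ σ' → Q σ' → Q' σ') : Run M D p σ T₂ Q' := by
  intro hσ
  obtain ⟨T', σ', hT', he, hb, hq⟩ := h hσ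
  exact ⟨T', σ', hT'.trans hT, he, hb, hQ σ' he.frame hq⟩

theorem Run.seq (h : Run M D p σ T₁ (fun σ₁ => Run M D q σ₁ T₂ Q)) :
    Run M D (.seq p q) σ (T₁ + T₂) Q := by
  intro hσ
  obtain ⟨T', σ', hT', he, hb, hq⟩ := h hσ
  obtain ⟨T'', σ'', hT'', he', hb', hq'⟩ := hq hb
  exact ⟨_, σ'', Nat.add_le_add hT' hT'', .seq _ _ _ _ _ _ _ he he', hb', hq'⟩

/-- The weakest precondition of a program without loops, in memories with entries at most `M`. -/
def Prog.wp (M : ℕ) : Prog → (State → Prop) → State → Prop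
  | .skip, Q, σ => Q σ
  | .assign x e, Q, σ => e.eval σ ≤ M ∧ Q (σ.setReg x (e.eval σ))
  | .store a i e, Q, σ => e.eval σ ≤ M ∧ Q (σ.setArr a (i.eval σ) (e.eval σ))
  | .seq p q, Q, σ => p.wp M (q.wp M Q) σ
  | .cond e p q, Q, σ => (e.eval σ ≠ 0 → p.wp M Q σ) ∧ (e.eval σ = 0 → q.wp M Q σ)
  | .loop _ _, _, _ => False

/-- A bound for the running time of a program without loops. -/
def Prog.maxCost : Prog → ℕ
  | .skip => 1
  | .assign _ e => e.cost + 1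
  | .store _ i e => i.cost + e.cost + 1
  | .seq p q => p.maxCost + q.maxCost
  | .cond e p q => e.cost + 1 + max p.maxCost q.maxCost
  | .loop _ _ => 0

theorem Run.of_wp (hM : 2 ≤ M) (hD : p.lev ≤ D) (h : p.wp M Q σ) :
    Run M D p σ p.maxCost Q := by
  induction p generalizing σ Q with
  | skip => exact fun hσ => ⟨_, σ, le_rfl, .skip σ, hσ, h⟩
  | assign x e =>
    exact fun hσ => ⟨_, _, le_rfl, .assign σ x e (e.within_of_lev hM hσ hD), hσ.setReg h.1, h.2⟩
  | store a i e =>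
    exact fun hσ => ⟨_, _, le_rfl, .store σ a i e
      (i.within_of_lev hM hσ ((le_max_left _ _).trans hD))
      (e.within_of_lev hM hσ ((le_max_right _ _).trans hD)), hσ.setArr h.1, h.2⟩
  | seq p q ihp ihq =>
    refine Run.seq ((ihp ((le_max_left _ _).trans hD) h).mono le_rfl fun σ' _ h' => ?_)
    exact ihq ((le_max_right _ _).trans hD) h'
  | cond e p q ihp ihq =>
    intro hσ
    simp only [Prog.lev, max_le_iff] at hD
    have hw := e.within_of_lev hM hσ hD.1
    by_cases he : e.eval σ = 0
    · obtain ⟨T', σ', hT', hx, hb, hq⟩ := ihq hD.2.2 (h.2 he) hσ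
      exact ⟨_, σ', Nat.add_le_add_left (hT'.trans (le_max_right _ _)) _,
        .cond_false e p q σ σ' T' hw he hx, hb, hq⟩
    · obtain ⟨T', σ', hT', hx, hb, hq⟩ := ihp hD.2.1 (h.1 he) hσ
      exact ⟨_, σ', Nat.add_le_add_left (hT'.trans (le_max_left _ _)) _,
        .cond_true e p q σ σ' T' hw he hx, hb, hq⟩
  | loop => exact h.elim

theorem Run.store {a : ℕ} {i e : Expr} (hM : 2 ≤ M)
    (hD : max i.lev e.lev ≤ D) (he : e.eval σ ≤ M) (h : Q (σ.setArr a (i.eval σ) (e.eval σ))) :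
    Run M D (.store a i e) σ (i.cost + e.cost + 1) Q :=
  Run.of_wp (p := .store a i e) hM hD ⟨he, h⟩

theorem Run.cond {e : Expr} (hM : 2 ≤ M) (hD : e.lev ≤ D)
    (h₁ : e.eval σ ≠ 0 → Run M D p σ T Q) (h₂ : e.eval σ = 0 → Run M D q σ T Q) :
    Run M D (.cond e p q) σ (e.cost + 1 + T) Q := by
  intro hσ
  have hw := e.within_of_lev hM hσ hD
  by_cases he : e.eval σ = 0
  · obtain ⟨T', σ', hT', hx, hb, hq⟩ := h₂ he hσ
    exact ⟨_, σ', Nat.add_le_add_left hT' _, .cond_false e p q σ σ' T' hw he hx, hb, hq⟩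
  · obtain ⟨T', σ', hT', hx, hb, hq⟩ := h₁ he hσ
    exact ⟨_, σ', Nat.add_le_add_left hT' _, .cond_true e p q σ σ' T' hw he hx, hb, hq⟩

/-- Execute `p` with register `x` running through the numbers below register `y`. -/
def forLoop (x y : ℕ) (p : Prog) : Prog :=
  .seq (.assign x 0) (.loop (Expr.lt (.reg x) (.reg y)) (.seq p (.assign x (.reg x + 1))))

/-- The rule for loops with an invariant. In the proof of a loop body, everything that the loop does not
write to is known to be unchanged since the start of the loop. -/
theorem Run.forLoop {x y N Tb : ℕ} (Inv : ℕ → State → Prop) (hM : 2 ≤ M) (hD : 2 ≤ D)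
    (hN : N ≤ M) (hy : σ.reg y = N) (hxy : y ≠ x) (hmx : p.modR x = false)
    (hmy : p.modR y = false) (h0 : Inv 0 (σ.setReg x 0))
    (hstep : ∀ j < N, ∀ σ', Frame (forLoop x y p) σ σ' → σ'.reg x = j → Inv j σ' →
      Run M D p σ' Tb (fun σ'' => Inv (j + 1) (σ''.setReg x (j + 1)))) :
    Run M D (WordRAM.forLoop x y p) σ (N * (Tb + 8) + 6) (Inv N) := by
  set l : Prog := .loop (Expr.lt (.reg x) (.reg y)) (.seq p (.assign x (.reg x + 1))) with hl
  have hmod : (WordRAM.forLoop x y p).modR y = false := by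
    simp [WordRAM.forLoop, Prog.modR, hxy, hmy]
  have hlev : (Expr.lt (.reg x) (.reg y)).lev ≤ D :=
    le_trans (show 1 ≤ 2 by omega) hD
  have main : ∀ r j, j + r = N → ∀ σ', Frame (WordRAM.forLoop x y p) σ σ' → σ'.reg x = j →
      Inv j σ' → Run M D l σ' (r * (Tb + 8) + 4) (Inv N) := by
    intro r
    induction r with
    | zero =>
      intro j hj σ' hf hx hi hσ
      refine ⟨_, σ', ?_, .loop_false _ _ _ (Expr.within_of_lev hM hσ _ hlev) ?_, hσ, ?_⟩
      · simp [Expr.lt, Expr.cost]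
      · simp [hx, hf.1 y hmod, hy, ← hj]
      · rwa [← hj]
    | succ r ih =>
      intro j hj σ' hf hx hi hσ
      obtain ⟨T', σ₁, hT', he, hb, hq⟩ := hstep j (by omega) σ' hf hx hi hσ
      have hf₁ := he.frame
      have hx₁ : (Expr.reg x + 1).eval σ₁ = j + 1 := by simp [hf₁.1 x hmx, hx]
      have he' : Exec (M ^ D) (.assign x (.reg x + 1)) σ₁ 4 (σ₁.setReg x (j + 1)) := by
        have := Exec.assign (B := M ^ D) σ₁ x (.reg x + 1)
          (Expr.within_of_lev hM hb (.reg x + 1) hD)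
        rwa [hx₁] at this
      have hb' : (σ₁.setReg x (j + 1)).Bdd M := hb.setReg (by omega)
      have hf' : Frame (WordRAM.forLoop x y p) σ (σ₁.setReg x (j + 1)) := by
        refine ⟨fun z hz => ?_, fun a ha => ?_⟩
        · have hzx : z ≠ x := by
            rintro rfl
            simp [WordRAM.forLoop, Prog.modR] at hz
          have hz' : p.modR z = false := by
            simp only [WordRAM.forLoop, Prog.modR, Bool.or_eq_false_iff] at hz
            exact hz.2.1
          simp [hzx, hf₁.1 z hz', hf.1 z hz]
        · have ha' : p.modA a = false := by
            simp only [WordRAM.forLoop, Prog.modA, Bool.or_eq_false_iff] at ha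
            exact ha.2.1
          rw [State.setReg_arr, hf₁.2 a ha', hf.2 a ha]
      obtain ⟨T'', σ₂, hT'', he₂, hb₂, hq₂⟩ := ih (j + 1) (by omega) _ hf' (by simp) hq hb'
      refine ⟨_, σ₂, ?_, .loop_true _ _ _ _ _ _ _ (Expr.within_of_lev hM hσ _ hlev) ?_
        (.seq _ _ _ _ _ _ _ he he') he₂, hb₂, hq₂⟩
      · have : (Expr.lt (.reg x) (.reg y)).cost = 3 := rfl
        rw [this, Nat.succ_mul]
        omega
      · have hjN : j < N := by omega
        simp [hx, hf.1 y hmod, hy, hjN]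
  intro hσ
  have hinit : Frame (WordRAM.forLoop x y p) σ (σ.setReg x 0) := by
    refine ⟨fun z hz => ?_, fun a ha => rfl⟩
    have hzx : z ≠ x := by
      rintro rfl
      simp [WordRAM.forLoop, Prog.modR] at hz
    simp [hzx]
  obtain ⟨T', σ', hT', he, hb, hq⟩ := main N 0 (by omega) _ hinit (by simp) h0
    (hσ.setReg (Nat.zero_le _))
  refine ⟨_, σ', ?_, .seq _ _ _ _ _ 2 _ (.assign σ x 0 (Nat.zero_le _)) he, hb, hq⟩
  omega

end WordRAM

/-! ### A recursion for independent sets of top-drawn rectangles -/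

/-- Tasks `0, …, n - 1` with chosen bottleneck edges `e`, and a dummy task `n` that serves as a wall
on both sides of the path: in the role of a left neighbour it ends at the vertex `0`, in the role of
a right neighbour it starts behind all tasks. -/
structure Boxes where
  n : ℕ
  s : ℕ → ℕ
  t : ℕ → ℕ
  d : ℕ → ℕ
  w : ℕ → ℕ
  e : ℕ → ℕ
  b : ℕ → ℕ
  s_le_e : ∀ i < n, s i ≤ e i
  e_lt_t : ∀ i < n, e i < t i
  d_pos : ∀ i < n, 0 < d i
  b_le : ∀ i < n, ∀ j < n, s j ≤ e i → e i < t j → b j ≤ b i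
  t_n : t n = 0
  b_n : b n = 0
  le_s_n : ∀ i < n, t i ≤ s n

namespace Boxes

variable {K : Boxes} {i k q j j' : ℕ}

/-- The lower end of the rectangle of task `i`, if `d i ≤ b i`. -/
def l (K : Boxes) (i : ℕ) : ℕ := K.b i - K.d i

/-- The rectangles of `i` and `j` do not overlap. -/
def Compat (K : Boxes) (i j : ℕ) : Prop :=
  K.t i ≤ K.s j ∨ K.t j ≤ K.s i ∨ K.b i ≤ K.l j ∨ K.b j ≤ K.l i

/-- Task `q` lies between the tasks `i` and `k`: its rectangle is in the region that is bounded on the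
left by the rectangle of `i` and, above that, by the capacity profile at the bottleneck edge of `i`;
on the right similarly for `k`; and below by the higher one of the lower ends of `i` and `k`. -/
def Between (K : Boxes) (i k q : ℕ) : Prop :=
  K.d q ≤ K.b q ∧ K.l i ≤ K.l q ∧ K.l k ≤ K.l q ∧
    (K.t i ≤ K.s q ∨ K.b i ≤ K.l q ∧ K.e i < K.s q) ∧
    (K.t q ≤ K.s k ∨ K.b k ≤ K.l q ∧ K.t q ≤ K.e k)

/-- `F` is a set of pairwise compatible tasks between `i` and `k`. -/
def Indep (K : Boxes) (i k : ℕ) (F : Finset ℕ) : Prop :=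
  (∀ j ∈ F, j < K.n ∧ K.Between i k j) ∧ ∀ j ∈ F, ∀ j' ∈ F, j ≠ j' → K.Compat j j'

/-- `v` bounds the profit of all independent sets between `i` and `k`. -/
def Bounds (K : Boxes) (v i k : ℕ) : Prop := ∀ F, K.Indep i k F → ∑ j ∈ F, K.w j ≤ v

open Classical in
/-- The number of tasks between `i` and `k`. -/
noncomputable def level (K : Boxes) (i k : ℕ) : ℕ := ((Finset.range K.n).filter (K.Between i k)).card

theorem Compat.symm (h : K.Compat i j) : K.Compat j i := by
  unfold Compat at *; tauto

theorem not_between_left (hq : q < K.n) : ¬ K.Between i q q := by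
  have := K.s_le_e q hq
  have := K.e_lt_t q hq
  unfold Between; omega

theorem not_between_right (hq : q < K.n) : ¬ K.Between q k q := by
  have := K.s_le_e q hq
  have := K.e_lt_t q hq
  unfold Between; omega

theorem Between.trans_left (hqn : q < K.n) (hq : K.Between i k q) (hj : K.Between i q j) :
    K.Between i k j := by
  have := K.s_le_e q hqn
  have := K.e_lt_t q hqn
  unfold Between at *
  omega

theorem Between.trans_right (hqn : q < K.n) (hq : K.Between i k q) (hj : K.Between q k j) :
    K.Between i k j := by
  have := K.s_le_e q hqn
  have := K.e_lt_t q hqn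
  unfold Between at *
  omega

/-- The task `q` with the lowest lower end splits the other ones into those between `i` and `q` and
those between `q` and `k`. -/
theorem Indep.exists_split {F : Finset ℕ} (hF : K.Indep i k F) (hne : F.Nonempty) :
    ∃ q ∈ F, ∀ j ∈ F, j ≠ q → K.Between i q j ∨ K.Between q k j := by
  obtain ⟨q, hq, hmin⟩ := Finset.exists_min_image F K.l hne
  refine ⟨q, hq, fun j hj hjq => ?_⟩
  have h1 := hmin j hj
  obtain ⟨hqn, hqb⟩ := hF.1 q hq
  obtain ⟨hjn, hjb⟩ := hF.1 j hj
  have h2 := hF.2 j hj q hq hjq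
  have h3 := K.b_le q hqn j hjn
  have h4 := K.d_pos j hjn
  unfold Between Compat at *
  unfold l at *
  omega

theorem Between.compat_left (hj : K.Between i q j) (hq : q < K.n) : K.Compat j q := by
  have := K.e_lt_t q hq
  unfold Between Compat at *
  omega

theorem Between.compat_right (hj : K.Between q k j) : K.Compat j q := by
  unfold Between Compat at *
  omega

/-- The bottleneck edge of `q` separates the tasks on its left from the tasks on its right. -/
theorem Between.t_le_s (hq : q < K.n) (hj : K.Between i q j) (hj' : K.Between q k j') :
    K.t j ≤ K.s j' := by
  have := K.s_le_e q hq
  have := K.e_lt_t q hq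
  unfold Between at *
  omega

theorem Indep.union {F F' : Finset ℕ} (hqn : q < K.n) (hq : K.Between i k q)
    (hF : K.Indep i q F) (hF' : K.Indep q k F') :
    K.Indep i k (insert q (F ∪ F')) ∧
      ∑ j ∈ insert q (F ∪ F'), K.w j = K.w q + ∑ j ∈ F, K.w j + ∑ j ∈ F', K.w j := by
  have hlr : ∀ j ∈ F, ∀ j' ∈ F', K.t j ≤ K.s j' := fun j hj j' hj' =>
    (hF.1 j hj).2.t_le_s hqn (hF'.1 j' hj').2
  refine ⟨⟨fun j hj => ?_, fun j hj j' hj' hne => ?_⟩, ?_⟩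
  · rw [Finset.mem_insert, Finset.mem_union] at hj
    rcases hj with rfl | hj | hj
    · exact ⟨hqn, hq⟩
    · exact ⟨(hF.1 j hj).1, hq.trans_left hqn (hF.1 j hj).2⟩
    · exact ⟨(hF'.1 j hj).1, hq.trans_right hqn (hF'.1 j hj).2⟩
  · rw [Finset.mem_insert, Finset.mem_union] at hj hj'
    have hl : ∀ j ∈ F, K.Compat j q := fun j hj => (hF.1 j hj).2.compat_left hqn
    have hr : ∀ j ∈ F', K.Compat j q := fun j hj => (hF'.1 j hj).2.compat_right
    rcases hj with rfl | hj | hj <;> rcases hj' with rfl | hj' | hj'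
    · exact absurd rfl hne
    · exact (hl j' hj').symm
    · exact (hr j' hj').symm
    · exact hl j hj
    · exact hF.2 j hj j' hj' hne
    · exact Or.inl (hlr j hj j' hj')
    · exact hr j hj
    · exact Or.inr (Or.inl (hlr j' hj' j hj))
    · exact hF'.2 j hj j' hj' hne
  · rw [Finset.sum_insert, Finset.sum_union, add_assoc]
    · rw [Finset.disjoint_left]
      intro j hj hj'
      have h1 := hlr j hj j hj'
      have h2 := K.s_le_e j (hF.1 j hj).1
      have h3 := K.e_lt_t j (hF.1 j hj).1
      omega
    · rw [Finset.mem_union, not_or]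
      exact ⟨fun h => not_between_left hqn (hF.1 q h).2,
        fun h => not_between_right hqn (hF'.1 q h).2⟩

/-- The recursion of the dynamic program. -/
theorem bounds_of_forall {v : ℕ} {f : ℕ → ℕ → ℕ}
    (h : ∀ q < K.n, K.Between i k q → K.Bounds (f i q) i q ∧ K.Bounds (f q k) q k ∧
      K.w q + f i q + f q k ≤ v) : K.Bounds v i k := by
  classical
  intro F hF
  rcases F.eq_empty_or_nonempty with rfl | hne
  · simp
  obtain ⟨q, hq, hsplit⟩ := hF.exists_split hne
  obtain ⟨hl, hr, hv⟩ := h q (hF.1 q hq).1 (hF.1 q hq).2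
  have h1 := hl ((F.erase q).filter (fun j => K.Between i q j)) ⟨fun j hj => by
      simp only [Finset.mem_filter, Finset.mem_erase] at hj
      exact ⟨(hF.1 j hj.1.2).1, hj.2⟩, fun j hj j' hj' => by
      simp only [Finset.mem_filter, Finset.mem_erase] at hj hj'
      exact hF.2 j hj.1.2 j' hj'.1.2⟩
  have h2 := hr ((F.erase q).filter (fun j => ¬ K.Between i q j)) ⟨fun j hj => by
      simp only [Finset.mem_filter, Finset.mem_erase] at hj
      exact ⟨(hF.1 j hj.1.2).1, (hsplit j hj.1.2 hj.1.1).resolve_left hj.2⟩, fun j hj j' hj' => by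
      simp only [Finset.mem_filter, Finset.mem_erase] at hj hj'
      exact hF.2 j hj.1.2 j' hj'.1.2⟩
  rw [← Finset.add_sum_erase F K.w hq,
    ← Finset.sum_filter_add_sum_filter_not (F.erase q) (fun j => K.Between i q j) K.w]
  omega

theorem level_left_lt (hqn : q < K.n) (hq : K.Between i k q) : K.level i q < K.level i k := by
  classical
  unfold level
  refine Finset.card_lt_card (Finset.ssubset_iff_of_subset ?_ |>.2 ⟨q, ?_, ?_⟩)
  · exact fun j hj => by
      rw [Finset.mem_filter] at hj ⊢
      exact ⟨hj.1, hq.trans_left hqn hj.2⟩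
  · simp [hqn, hq]
  · simp [not_between_left hqn]

theorem level_right_lt (hqn : q < K.n) (hq : K.Between i k q) : K.level q k < K.level i k := by
  classical
  unfold level
  refine Finset.card_lt_card (Finset.ssubset_iff_of_subset ?_ |>.2 ⟨q, ?_, ?_⟩)
  · exact fun j hj => by
      rw [Finset.mem_filter] at hj ⊢
      exact ⟨hj.1, hq.trans_right hqn hj.2⟩
  · simp [hqn, hq]
  · simp [not_between_right hqn]

theorem level_le : K.level i k ≤ K.n := by
  classical
  exact (Finset.card_filter_le _ _).trans (by simp)

theorem between_n (hq : q < K.n) : K.Between K.n K.n q ↔ K.d q ≤ K.b q := by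
  have := K.t_n
  have := K.b_n
  have := K.le_s_n q hq
  unfold Between l
  omega

end Boxes

namespace WordRAM

/-! ### The dynamic program on a word RAM -/

theorem index_eq_iff {N i k i' k' : ℕ} (hk : k < N) (hk' : k' < N) :
    i * N + k = i' * N + k' ↔ i = i' ∧ k = k' := by
  refine ⟨fun h => ?_, by rintro ⟨rfl, rfl⟩; rfl⟩
  have hN : 0 < N := by omega
  have h1 : (i * N + k) / N = i := by
    rw [add_comm, Nat.add_mul_div_right _ _ hN, Nat.div_eq_of_lt hk, zero_add]
  have h2 : (i' * N + k') / N = i' := by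
    rw [add_comm, Nat.add_mul_div_right _ _ hN, Nat.div_eq_of_lt hk', zero_add]
  have hi : i = i' := by rw [← h1, h, h2]
  subst hi
  exact ⟨rfl, by omega⟩

/-- The index of the entry for the pair of the tasks in the registers `a` and `b`, in a table with
rows of the length in register `9`. -/
def pairIdx (a b : ℕ) : Expr := .reg a * .reg 9 + .reg b

/-- The index of the entry for the three tasks in the registers `a`, `b` and `c`. -/
def tripleIdx (a b c : ℕ) : Expr := pairIdx a b * .reg 9 + .reg c

/-- `Boxes.l` for the task in register `x`. -/
def lowerEnd (x : ℕ) : Expr := .get 9 (.reg x) - .get 3 (.reg x)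

/-- Test for `Boxes.Between`, for the tasks `i`, `k` and `q` in the registers `3`, `4` and `5`. -/
def betweenTest : Expr :=
  Expr.le (.get 3 (.reg 5)) (.get 9 (.reg 5)) * Expr.le (lowerEnd 3) (lowerEnd 5) *
    Expr.le (lowerEnd 4) (lowerEnd 5) *
    (Expr.le (.get 2 (.reg 3)) (.get 1 (.reg 5)) +
      Expr.le (.get 9 (.reg 3)) (lowerEnd 5) * Expr.lt (.get 8 (.reg 3)) (.get 1 (.reg 5))) *
    (Expr.le (.get 2 (.reg 5)) (.get 1 (.reg 4)) +
      Expr.le (.get 9 (.reg 4)) (lowerEnd 5) * Expr.le (.get 2 (.reg 5)) (.get 8 (.reg 4)))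

/-- The profit that is available between the tasks `i` and `k` if the task `q` is taken. -/
def candidate : Expr :=
  .get 4 (.reg 5) + .get 11 (pairIdx 3 5) + .get 11 (pairIdx 5 4)

/-- Consider the task in register `5` as a task to be taken between those in registers `3` and `4`. -/
def scanBody : Prog :=
  .cond betweenTest
    (.cond (Expr.lt (.reg 6) candidate) (.seq (.assign 6 candidate) (.assign 7 (.reg 5))) .skip)
    .skip

/-- Decide whether the task in register `8` belongs to the new set for the tasks in registers `3` and
`4`, if the task in register `7` is taken. -/
def copyBody : Prog :=
  .store 12 (tripleIdx 3 4 8) (Expr.lt 0 (.get 12 (tripleIdx 3 7 8) + .get 12 (tripleIdx 7 4 8) +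
    .op .equal (.reg 7) (.reg 8)))

/-- Start the search for a better value at the present one, and with the dummy task. -/
def improveInit : Prog := .seq (.assign 6 (.get 11 (pairIdx 3 4))) (.assign 7 (.reg 0))

/-- If a better value has been found, store it, together with the set that attains it. -/
def updateTables : Prog :=
  .cond (Expr.lt (.reg 7) (.reg 0))
    (.seq (.store 11 (pairIdx 3 4) (.reg 6)) (forLoop 8 0 copyBody)) .skip

/-- Improve the table entry for the tasks `i` and `k` in the registers `3` and `4`. -/
def improve : Prog := .seq improveInit (.seq (forLoop 5 0 scanBody) updateTables)

/-- `n` rounds of improvements of all table entries. -/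
def rounds : Prog := forLoop 2 0 (forLoop 3 9 (forLoop 4 9 improve))

/-- The memory holds the data of `K`. -/
structure Holds (K : Boxes) (σ : State) : Prop where
  n : σ.reg 0 = K.n
  len : σ.reg 9 = K.n + 1
  s : σ.arr 1 = K.s
  t : σ.arr 2 = K.t
  d : σ.arr 3 = K.d
  w : σ.arr 4 = K.w
  e : σ.arr 8 = K.e
  b : σ.arr 9 = K.b

theorem Holds.of_frame {K : Boxes} {σ σ' : State} {p : Prog} (h : Holds K σ) (hf : Frame p σ σ')
    (hp : (p.modR 0 || p.modR 9 || p.modA 1 || p.modA 2 || p.modA 3 || p.modA 4 || p.modA 8 ||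
      p.modA 9) = false) : Holds K σ' := by
  simp only [Bool.or_eq_false_iff] at hp
  obtain ⟨⟨⟨⟨⟨⟨⟨h0, h9⟩, h1⟩, h2⟩, h3⟩, h4⟩, h8⟩, h9'⟩ := hp
  exact ⟨(hf.1 _ h0).trans h.n, (hf.1 _ h9).trans h.len, (hf.2 _ h1).trans h.s,
    (hf.2 _ h2).trans h.t, (hf.2 _ h3).trans h.d, (hf.2 _ h4).trans h.w, (hf.2 _ h8).trans h.e,
    (hf.2 _ h9').trans h.b⟩

/-- The value in the table for the pair `i`, `k`. -/
def val (K : Boxes) (σ : State) (i k : ℕ) : ℕ := σ.arr 11 (i * (K.n + 1) + k)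

/-- The indicator vector in the table for the pair `i`, `k`. -/
def ind (K : Boxes) (σ : State) (i k j : ℕ) : ℕ := σ.arr 12 ((i * (K.n + 1) + k) * (K.n + 1) + j)

/-- The set of tasks in the table for the pair `i`, `k`. -/
def sel (K : Boxes) (σ : State) (i k : ℕ) : Finset ℕ :=
  (Finset.range K.n).filter (fun j => ind K σ i k j ≠ 0)

theorem sel_congr {K : Boxes} {σ σ' : State} (h : σ'.arr 12 = σ.arr 12) : sel K σ' = sel K σ := by
  unfold sel ind
  rw [h]

/-- Each table entry consists of an independent set and its profit. -/
def Sound (K : Boxes) (σ : State) : Prop :=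
  ∀ i ≤ K.n, ∀ k ≤ K.n, K.Indep i k (sel K σ i k) ∧ ∑ j ∈ sel K σ i k, K.w j = val K σ i k

/-- The value of `candidate` for the tasks `i`, `k` and `q`. -/
def cand (K : Boxes) (σ : State) (i k q : ℕ) : ℕ := K.w q + val K σ i q + val K σ q k

variable {K : Boxes} {M : ℕ} {σ : State} {i k : ℕ}

theorem Sound.val_le (h : Sound K σ) (hi : i ≤ K.n) (hk : k ≤ K.n) :
    val K σ i k ≤ ∑ j ∈ Finset.range K.n, K.w j := by
  rw [← (h i hi k hk).2]
  exact Finset.sum_le_sum_of_subset (Finset.filter_subset _ _)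

theorem Sound.cand_le (h : Sound K σ) (hi : i ≤ K.n) (hk : k ≤ K.n) {q : ℕ} (hq : q < K.n) :
    cand K σ i k q ≤ 3 * ∑ j ∈ Finset.range K.n, K.w j := by
  have h1 := h.val_le hi hq.le
  have h2 := h.val_le hq.le hk
  have h3 := Finset.single_le_sum (f := K.w) (fun _ _ => Nat.zero_le _) (Finset.mem_range.2 hq)
  unfold cand
  omega

theorem betweenTest_ne_zero (h : Holds K σ) (hi : σ.reg 3 = i) (hk : σ.reg 4 = k) :
    betweenTest.eval σ ≠ 0 ↔ K.Between i k (σ.reg 5) := by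
  simp [betweenTest, lowerEnd, h.s, h.t, h.d, h.e, h.b, hi, hk, Boxes.Between, Boxes.l]
  omega

theorem candidate_eval (h : Holds K σ) (hi : σ.reg 3 = i) (hk : σ.reg 4 = k) :
    candidate.eval σ = cand K σ i k (σ.reg 5) := by
  simp [candidate, pairIdx, h.w, h.len, hi, hk, cand, val]

/-- The invariant of the search for the best task between `i` and `k`: register `6` holds the best
value that has been found so far, and register `7` the task that attains it. -/
def ScanInv (K : Boxes) (σ₀ : State) (i k j : ℕ) (σ : State) : Prop :=
  (∀ q < j, K.Between i k q → cand K σ₀ i k q ≤ σ.reg 6) ∧ val K σ₀ i k ≤ σ.reg 6 ∧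
    (σ.reg 7 = K.n ∧ σ.reg 6 = val K σ₀ i k ∨
      σ.reg 7 < K.n ∧ K.Between i k (σ.reg 7) ∧ σ.reg 6 = cand K σ₀ i k (σ.reg 7))

theorem run_scan (hM : 2 ≤ M) (hn : K.n + 1 ≤ M) (hw : 3 * ∑ j ∈ Finset.range K.n, K.w j ≤ M)
    (h : Holds K σ) (hs : Sound K σ) (hi : i ≤ K.n) (hk : k ≤ K.n) (h3 : σ.reg 3 = i)
    (h4 : σ.reg 4 = k) (h6 : σ.reg 6 = val K σ i k) (h7 : σ.reg 7 = K.n) :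
    Run M 20 (forLoop 5 0 scanBody) σ (K.n * (200 + 8) + 6) (ScanInv K σ i k K.n) := by
  refine Run.forLoop (N := K.n) (Tb := 200) (ScanInv K σ i k) hM (by omega) (by omega) h.n
    (by decide) rfl rfl ?_ ?_
  · simp [ScanInv, h6, h7]
  intro j hj σ' hf hx hinv
  have h' : Holds K σ' := h.of_frame hf rfl
  have h3' : σ'.reg 3 = i := (hf.1 3 rfl).trans h3
  have h4' : σ'.reg 4 = k := (hf.1 4 rfl).trans h4
  have hcand : cand K σ' = cand K σ := by
    funext i k q
    simp [cand, val, hf.2 11 rfl]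
  have hb := betweenTest_ne_zero h' h3' h4'
  have hc := candidate_eval h' h3' h4'
  rw [hx] at hb hc
  rw [hcand] at hc
  refine (Run.of_wp (p := scanBody) hM (by decide) ?_).mono (by decide) (fun _ _ h => h)
  obtain ⟨ha, hv, hb7⟩ := hinv
  simp only [scanBody, Prog.wp, Expr.eval_lt, Expr.eval_reg, hc, Expr.eval_reg]
  refine ⟨fun hne => ⟨fun hlt => ?_, fun hlt => ?_⟩, fun heq => ?_⟩
  · have hlt' : σ'.reg 6 < cand K σ i k j := by simpa using hlt
    refine ⟨(hs.cand_le hi hk hj).trans hw, ?_, ?_⟩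
    · simp [hx]; omega
    refine ⟨fun q hq hq' => ?_, ?_, Or.inr ?_⟩
    · simp
      rcases Nat.lt_succ_iff_lt_or_eq.1 hq with hq | rfl
      · exact (ha q hq hq').trans hlt'.le
      · exact le_rfl
    · simpa using hv.trans hlt'.le
    · simpa [hx] using ⟨hj, hb.1 hne⟩
  · have hlt' : cand K σ i k j ≤ σ'.reg 6 := by simpa using hlt
    refine ⟨fun q hq hq' => ?_, by simpa using hv, by simpa using hb7⟩
    simp
    rcases Nat.lt_succ_iff_lt_or_eq.1 hq with hq | rfl
    · exact ha q hq hq'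
    · exact hlt'
  · refine ⟨fun q hq hq' => ?_, by simpa using hv, by simpa using hb7⟩
    simp
    rcases Nat.lt_succ_iff_lt_or_eq.1 hq with hq | rfl
    · exact ha q hq hq'
    · exact absurd heq (hb.2 hq')

/-- In the table of the indicator vectors, the entry for `i`, `k` is replaced by the union of those for
`i`, `q` and for `q`, `k` and of `{q}`. -/
theorem run_copy (hM : 2 ≤ M) (hn : K.n + 1 ≤ M) (h : Holds K σ) (hi : i ≤ K.n) (hk : k ≤ K.n)
    (h3 : σ.reg 3 = i) (h4 : σ.reg 4 = k) {q : ℕ} (h7 : σ.reg 7 = q) (hqn : q < K.n)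
    (hqi : q ≠ i) (hqk : q ≠ k) :
    Run M 20 (forLoop 8 0 copyBody) σ (K.n * (100 + 8) + 6) (fun σ' =>
      sel K σ' i k = insert q (sel K σ i q ∪ sel K σ q k) ∧
      ∀ i' ≤ K.n, ∀ k' ≤ K.n, ¬ (i' = i ∧ k' = k) → sel K σ' i' k' = sel K σ i' k') := by
  refine (Run.forLoop (N := K.n) (Tb := 100) (fun j σ' =>
    ∀ i' ≤ K.n, ∀ k' ≤ K.n, ∀ c < K.n, (ind K σ' i' k' c ≠ 0 ↔
      if i' = i ∧ k' = k ∧ c < j then ind K σ i q c ≠ 0 ∨ ind K σ q k c ≠ 0 ∨ c = q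
      else ind K σ i' k' c ≠ 0)) hM (by omega) (by omega) h.n (by decide) rfl rfl ?_ ?_).mono
    le_rfl ?_
  · intro i' _ k' _ c _
    simp [ind]
  · intro j hj σ' hf hx hinv
    have h' : Holds K σ' := h.of_frame hf rfl
    have h3' : σ'.reg 3 = i := (hf.1 3 rfl).trans h3
    have h4' : σ'.reg 4 = k := (hf.1 4 rfl).trans h4
    have h7' : σ'.reg 7 = q := (hf.1 7 rfl).trans h7
    have hidx : ∀ a b c, (tripleIdx a b c).eval σ' =
        (σ'.reg a * (K.n + 1) + σ'.reg b) * (K.n + 1) + σ'.reg c := by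
      intro a b c
      simp [tripleIdx, pairIdx, h'.len]
    obtain ⟨v, hv⟩ : ∃ v, (Expr.lt 0 (.get 12 (tripleIdx 3 7 8) + .get 12 (tripleIdx 7 4 8) +
        .op .equal (.reg 7) (.reg 8))).eval σ' = v := ⟨_, rfl⟩
    have hval : v ≤ 1 ∧ (v ≠ 0 ↔ ind K σ i q j ≠ 0 ∨ ind K σ q k j ≠ 0 ∨ j = q) := by
      have h1 := hinv i hi q hqn.le j hj
      have h2 := hinv q hqn.le k hk j hj
      rw [if_neg (by omega)] at h1 h2
      rw [← h1, ← h2, ← hv]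
      simp only [Expr.eval_lt, hidx, h3', h4', h7', hx, Expr.eval, Op.eval, ind]
      split_ifs <;> omega
    refine (Run.store hM (by decide) ?_ ?_).mono (T₁ := _) (by decide) (fun _ _ h => h)
    · omega
    intro i' hi' k' hk' c hc
    have h1 := hinv i' hi' k' hk' c hc
    have hiff : (i' * (K.n + 1) + k') * (K.n + 1) + c = (i * (K.n + 1) + k) * (K.n + 1) + j ↔
        (i' = i ∧ k' = k) ∧ c = j := by
      rw [index_eq_iff (by omega) (by omega), index_eq_iff (by omega) (by omega)]
    rw [hv, hidx, h3', h4', hx]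
    rw [ind, State.setReg_arr, State.setArr_arr, if_pos rfl, Function.update_apply]
    by_cases hcase : (i' = i ∧ k' = k) ∧ c = j
    · obtain ⟨⟨rfl, rfl⟩, rfl⟩ := hcase
      rw [if_pos rfl, if_pos (by omega), hval.2]
    · rw [if_neg (fun h => hcase (hiff.1 h))]
      rw [ind] at h1
      rw [h1]
      by_cases hlt : i' = i ∧ k' = k ∧ c < j
      · rw [if_pos hlt, if_pos (by omega)]
      · rw [if_neg hlt, if_neg (by omega)]
  · intro σ' _ hinv
    refine ⟨?_, fun i' hi' k' hk' hne => ?_⟩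
    · ext c
      simp only [sel, Finset.mem_filter, Finset.mem_insert, Finset.mem_union, Finset.mem_range]
      by_cases hc : c < K.n
      · rw [hinv i hi k hk c hc, if_pos ⟨rfl, rfl, hc⟩]
        tauto
      · have : c ≠ q := by omega
        tauto
    · refine Finset.filter_congr fun c hc => ?_
      rw [hinv i' hi' k' hk' c (Finset.mem_range.1 hc), if_neg (by tauto)]

/-- Improving an entry keeps the table sound and makes no value smaller; the new value of the entry
for `i`, `k` satisfies the inequalities of the recursion. -/
theorem run_improve (hM : 2 ≤ M) (hn : K.n + 1 ≤ M)
    (hw : 3 * ∑ j ∈ Finset.range K.n, K.w j ≤ M)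
    (h : Holds K σ) (hs : Sound K σ) (hi : i ≤ K.n) (hk : k ≤ K.n) (h3 : σ.reg 3 = i)
    (h4 : σ.reg 4 = k) :
    Run M 20 improve σ (400 * (K.n + 1)) (fun σ' => Sound K σ' ∧
      (∀ i' ≤ K.n, ∀ k' ≤ K.n, val K σ i' k' ≤ val K σ' i' k') ∧
      ∀ q < K.n, K.Between i k q → cand K σ i k q ≤ val K σ' i k) := by
  have h0 : Run M 20 improveInit σ 10 (fun σ₁ => σ₁.reg 6 = val K σ i k ∧ σ₁.reg 7 = K.n) := by
    refine (Run.of_wp (p := improveInit) hM (by decide) ?_).mono (by decide) (fun _ _ h => h)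
    have hv := hs.val_le hi hk
    have he : (pairIdx 3 4).eval σ = i * (K.n + 1) + k := by simp [pairIdx, h3, h4, h.len]
    simp only [improveInit, Prog.wp, Expr.eval_get, he, Expr.eval_reg, State.setReg_reg, h.n]
    refine ⟨?_, ?_, ?_⟩
    · change val K σ i k ≤ M
      omega
    · simp only [OfNat.zero_ne_ofNat, if_false]
      omega
    · simp [val]
  refine Run.mono (T₁ := 10 + ((K.n * (200 + 8) + 6) + (20 + (K.n * (100 + 8) + 6)))) ?_
    (by omega) (fun _ _ h => h)
  refine Run.seq (h0.mono le_rfl fun σ₁ hf₁ h₁ => Run.seq ?_)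
  have hH₁ : Holds K σ₁ := h.of_frame hf₁ rfl
  have hval₁ : ∀ i k, val K σ₁ i k = val K σ i k := fun i k => by
    simp [val, hf₁.2 11 rfl]
  have hsel₁ : ∀ i k, sel K σ₁ i k = sel K σ i k := fun i k => by
    rw [sel_congr (hf₁.2 12 rfl)]
  have hs₁ : Sound K σ₁ := fun i hi k hk => by
    rw [hval₁, hsel₁]; exact hs i hi k hk
  have hcand₁ : ∀ i k q, cand K σ₁ i k q = cand K σ i k q := fun i k q => by
    simp [cand, hval₁]
  refine (run_scan hM hn hw hH₁ hs₁ hi hk ((hf₁.1 3 rfl).trans h3) ((hf₁.1 4 rfl).trans h4)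
    (by rw [h₁.1, hval₁]) h₁.2).mono le_rfl fun σ₂ hf₂ h₂ => ?_
  have hH₂ : Holds K σ₂ := hH₁.of_frame hf₂ rfl
  have hval₂ : ∀ i k, val K σ₂ i k = val K σ i k := fun i k => by
    rw [← hval₁]; simp [val, hf₂.2 11 rfl]
  have hsel₂ : ∀ i k, sel K σ₂ i k = sel K σ i k := fun i k => by
    rw [← hsel₁, sel_congr (hf₂.2 12 rfl)]
  have h3₂ : σ₂.reg 3 = i := (hf₂.1 3 rfl).trans ((hf₁.1 3 rfl).trans h3)
  have h4₂ : σ₂.reg 4 = k := (hf₂.1 4 rfl).trans ((hf₁.1 4 rfl).trans h4)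
  obtain ⟨hall, hge, hbest⟩ := h₂
  simp only [hcand₁, hval₁] at hall hge hbest
  have htest : (Expr.lt (.reg 7) (.reg 0)).eval σ₂ ≠ 0 ↔ σ₂.reg 7 < K.n := by
    simp [hH₂.n]
  refine (Run.cond (T := 20 + (K.n * (100 + 8) + 6) - 4) hM (by decide) (fun hlt => ?_)
    (fun hge' => ?_)).mono ?_ (fun _ _ h => h)
  · rw [htest] at hlt
    obtain ⟨-, hbq, h6⟩ := hbest.resolve_left fun h => by omega
    set q := σ₂.reg 7 with hq
    have hqi : q ≠ i := by
      intro hqi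
      rw [← hqi] at hbq
      exact Boxes.not_between_right hlt hbq
    have hqk : q ≠ k := by
      intro hqk
      rw [← hqk] at hbq
      exact Boxes.not_between_left hlt hbq
    refine Run.mono (T₁ := 7 + (K.n * (100 + 8) + 6)) (Run.seq ?_) (by omega)
      (fun _ _ h => h)
    refine (Run.store hM (by decide) ?_ ?_).mono (Q := fun σ₃ =>
      σ₃ = σ₂.setArr 11 (i * (K.n + 1) + k) (cand K σ i k q)) (by decide) fun σ₃ _ hσ₃ => ?_
    · have := hs.cand_le hi hk hlt
      simp only [Expr.eval_reg, h6]
      omega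
    · simp [pairIdx, h3₂, h4₂, hH₂.len, h6]
    have hH₃ : Holds K σ₃ := by
      subst hσ₃
      exact ⟨by simp [hH₂.n], by simp [hH₂.len], by simp [hH₂.s], by simp [hH₂.t], by simp [hH₂.d],
        by simp [hH₂.w], by simp [hH₂.e], by simp [hH₂.b]⟩
    refine (run_copy hM hn hH₃ hi hk (by simp [hσ₃, h3₂]) (by simp [hσ₃, h4₂]) (q := q)
      (by simp [hσ₃, hq]) hlt hqi hqk).mono le_rfl fun σ₄ hf₄ h₄ => ?_
    have hsel₃ : ∀ i k, sel K σ₃ i k = sel K σ i k := fun i k => by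
      rw [← hsel₂, sel_congr (σ' := σ₃) (σ := σ₂) (by simp [hσ₃])]
    simp only [hsel₃] at h₄
    have hvik : val K σ₄ i k = cand K σ i k q := by
      simp [val, hf₄.2 11 rfl, hσ₃]
    have hv : ∀ i' ≤ K.n, ∀ k' ≤ K.n, ¬ (i' = i ∧ k' = k) →
        val K σ₄ i' k' = val K σ i' k' := fun i' hi' k' hk' hne => by
      rw [← hval₂]
      simp only [val, hf₄.2 11 rfl, hσ₃, State.setArr_arr, if_true]
      rw [Function.update_apply, if_neg]
      rwa [index_eq_iff (by omega) (by omega)]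
    refine ⟨fun i' hi' k' hk' => ?_, fun i' hi' k' hk' => ?_, fun q' hq' hb' => ?_⟩
    · by_cases hik : i' = i ∧ k' = k
      · obtain ⟨rfl, rfl⟩ := hik
        obtain ⟨hl, hl'⟩ := hs i' hi' q hlt.le
        obtain ⟨hr, hr'⟩ := hs q hlt.le k' hk'
        have hu := hl.union hlt hbq hr
        rw [h₄.1, hvik]
        refine ⟨hu.1, ?_⟩
        rw [cand, ← hl', ← hr', ← hu.2]
      · rw [h₄.2 i' hi' k' hk' hik, hv i' hi' k' hk' hik]
        exact hs i' hi' k' hk'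
    · by_cases hik : i' = i ∧ k' = k
      · obtain ⟨rfl, rfl⟩ := hik
        omega
      · exact (hv i' hi' k' hk' hik).ge
    · have := hall q' hq' hb'
      omega
  · refine (Run.of_wp (p := .skip) hM (by decide) ?_).mono (T₁ := 1) (by omega)
      (fun _ _ h => h)
    have hn7 : ¬ σ₂.reg 7 < K.n := fun hlt => htest.2 hlt hge'
    have h6 := (hbest.resolve_right fun h => hn7 h.1).2
    refine ⟨fun i' hi' k' hk' => ?_, fun i' hi' k' hk' => (hval₂ i' k').ge, fun q hq hb => ?_⟩
    · rw [hval₂, hsel₂]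
      exact hs i' hi' k' hk'
    · rw [hval₂, ← h6]
      exact hall q hq hb
  · have : (Expr.lt (.reg 7) (.reg 0)).cost = 3 := rfl
    omega

/-- The table is sound, and the values are optimal for the pairs with at most `r` tasks in between, as
well as for those with `r + 1` tasks in between that satisfy `P`. -/
def Known (K : Boxes) (r : ℕ) (P : ℕ → ℕ → Prop) (σ : State) : Prop :=
  Sound K σ ∧ ∀ i ≤ K.n, ∀ k ≤ K.n, (K.level i k ≤ r ∨ K.level i k ≤ r + 1 ∧ P i k) →
    K.Bounds (val K σ i k) i k

theorem Known.mono {r r' : ℕ} {P P' : ℕ → ℕ → Prop} (h : Known K r P σ)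
    (hP : ∀ i ≤ K.n, ∀ k ≤ K.n, (K.level i k ≤ r' ∨ K.level i k ≤ r' + 1 ∧ P' i k) →
      K.level i k ≤ r ∨ K.level i k ≤ r + 1 ∧ P i k) : Known K r' P' σ :=
  ⟨h.1, fun i hi k hk hik => h.2 i hi k hk (hP i hi k hk hik)⟩

theorem Known.improve {r : ℕ} {P : ℕ → ℕ → Prop} {σ' : State} (h : Known K r P σ)
    (hs : Sound K σ') (hmono : ∀ i' ≤ K.n, ∀ k' ≤ K.n, val K σ i' k' ≤ val K σ' i' k')
    (hi : i ≤ K.n) (hk : k ≤ K.n)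
    (hc : ∀ q < K.n, K.Between i k q → cand K σ i k q ≤ val K σ' i k) :
    Known K r (fun i' k' => P i' k' ∨ i' = i ∧ k' = k) σ' := by
  refine ⟨hs, fun i' hi' k' hk' hik => ?_⟩
  by_cases hcase : i' = i ∧ k' = k
  · obtain ⟨rfl, rfl⟩ := hcase
    refine Boxes.bounds_of_forall (f := val K σ) fun q hq hb => ⟨?_, ?_, hc q hq hb⟩
    · have := Boxes.level_left_lt hq hb
      exact h.2 i' hi' q hq.le (by omega)
    · have := Boxes.level_right_lt hq hb
      exact h.2 q hq.le k' hk' (by omega)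
  · exact fun F hF => (h.2 i' hi' k' hk' (by tauto) F hF).trans (hmono i' hi' k' hk')

theorem run_rounds (hM : 2 ≤ M) (hn : K.n + 1 ≤ M)
    (hw : 3 * ∑ j ∈ Finset.range K.n, K.w j ≤ M) (h : Holds K σ) (hs : Sound K σ) :
    Run M 20 rounds σ (4000 * (K.n ^ 4 + 1)) (fun σ' =>
      Sound K σ' ∧ ∀ i ≤ K.n, ∀ k ≤ K.n, K.Bounds (val K σ' i k) i k) := by
  have hT : K.n * ((K.n + 1) * ((K.n + 1) * (400 * (K.n + 1) + 8) + 6 + 8) + 6 + 8) + 6 ≤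
      4000 * (K.n ^ 4 + 1) := by
    rcases Nat.eq_zero_or_pos K.n with h0 | h0
    · simp [h0]
    have h1 : K.n ≤ K.n ^ 4 := Nat.le_self_pow (by omega) _
    have h2 : K.n ^ 2 ≤ K.n ^ 4 := Nat.pow_le_pow_right h0 (by omega)
    have h3 : K.n ^ 3 ≤ K.n ^ 4 := Nat.pow_le_pow_right h0 (by omega)
    ring_nf
    omega
  refine (Run.forLoop (N := K.n) (fun r => Known K r (fun _ _ => False)) hM (by omega) (by omega)
    h.n (by decide) rfl rfl ⟨hs, ?_⟩ ?_).mono hT fun σ' _ h' =>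
      ⟨h'.1, fun i hi k hk => h'.2 i hi k hk (Or.inl Boxes.level_le)⟩
  · intro i _ k _ hik F hF
    simp only [and_false, or_false, Nat.le_zero, Boxes.level, Finset.card_eq_zero,
      Finset.filter_eq_empty_iff, Finset.mem_range] at hik
    have : F = ∅ := Finset.eq_empty_of_forall_notMem fun j hj => hik (hF.1 j hj).1 (hF.1 j hj).2
    simp [this]
  intro r _ σ₁ hf₁ _ hk₁
  have hH₁ : Holds K σ₁ := h.of_frame hf₁ rfl
  refine (Run.forLoop (N := K.n + 1) (fun a => Known K r (fun i' _ => i' < a)) hM (by omega) hn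
    hH₁.len (by decide) rfl rfl ?_ ?_).mono le_rfl fun σ' _ h' => ?_
  · exact Known.mono hk₁ fun _ _ _ _ h => by omega
  · intro i hi σ₂ hf₂ h3₂ hk₂
    have hH₂ : Holds K σ₂ := hH₁.of_frame hf₂ rfl
    refine (Run.forLoop (N := K.n + 1)
      (fun c => Known K r (fun i' k' => i' < i ∨ i' = i ∧ k' < c)) hM (by omega) hn
      hH₂.len (by decide) rfl rfl ?_ ?_).mono le_rfl fun σ' _ h' => ?_
    · exact Known.mono hk₂ fun _ _ _ _ h => by omega
    · intro k hk σ₃ hf₃ h4₃ hk₃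
      have hH₃ : Holds K σ₃ := hH₂.of_frame hf₃ rfl
      refine (run_improve hM hn hw hH₃ hk₃.1 (Nat.lt_succ_iff.1 hi) (Nat.lt_succ_iff.1 hk)
        ((hf₃.1 3 rfl).trans h3₂) h4₃).mono le_rfl fun σ' _ h' => ?_
      exact (hk₃.improve h'.1 h'.2.1 (Nat.lt_succ_iff.1 hi) (Nat.lt_succ_iff.1 hk) h'.2.2).mono
        fun _ _ _ _ h => by omega
    · exact Known.mono h' fun _ _ _ _ h => by omega
  · exact Known.mono h' fun _ _ _ _ h => by simp only [and_false, or_false] at h; omega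


/-! ### Finding the bottleneck edges -/

/-- Mark the end vertices of all tasks, and the last vertex of the path. -/
def markEnds : Prog :=
  .seq (.store 6 (.reg 1) 1)
    (forLoop 2 0 (.seq (.store 6 (.get 1 (.reg 2)) 1) (.store 6 (.get 2 (.reg 2)) 1)))

/-- Process one edge `v`, in register `3`, in a sweep from right to left. -/
def sweepBody : Prog :=
  .seq (.assign 3 (.reg 1 - (.reg 2 + 1))) (.seq (.store 7 (.reg 3) (.reg 3))
    (.cond (Expr.lt (.get 6 (.reg 3 + 1)) 1 *
        Expr.lt (.get 0 (.get 7 (.reg 3 + 1))) (.get 0 (.reg 3)))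
      (.store 7 (.reg 3) (.get 7 (.reg 3 + 1))) .skip))

/-- Compare the present candidate for the bottleneck edge of the task in register `2` with the
cheapest edge that follows the vertex in entry `j` of array `a`, where `j` is in register `3`. -/
def tryVertex (a : ℕ) : Prog :=
  .seq (.assign 5 (.get a (.reg 3)))
    (.cond (Expr.le (.get 1 (.reg 2)) (.reg 5) * Expr.lt (.reg 5) (.get 2 (.reg 2)) *
        Expr.lt (.get 0 (.get 7 (.reg 5))) (.get 0 (.reg 4)))
      (.assign 4 (.get 7 (.reg 5))) .skip)

/-- Find the bottleneck edge of the task in register `2`. -/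
def bottleneckBody : Prog :=
  .seq (.assign 4 (.get 7 (.get 1 (.reg 2))))
    (.seq (forLoop 3 0 (.seq (tryVertex 1) (tryVertex 2)))
      (.seq (.store 8 (.reg 2) (.reg 4)) (.store 9 (.reg 2) (.get 0 (.reg 4)))))

/-- Write the bottleneck edges to array `8` and the bottleneck capacities to array `9`. -/
def bottlenecks : Prog := .seq markEnds (.seq (forLoop 2 1 sweepBody) (forLoop 2 0 bottleneckBody))

/-- `a` is the cheapest edge of the path from vertex `x` to the next marked vertex. -/
def IsLeader (m : ℕ) (u mark : ℕ → ℕ) (x a : ℕ) : Prop :=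
  (x ≤ a ∧ a < m ∧ ∀ y, x < y → y ≤ a → mark y = 0) ∧
    ∀ e, x ≤ e → e < m → (∀ y, x < y → y ≤ e → mark y = 0) → u a ≤ u e

/-- `e` is an edge of least capacity between the vertices `s` and `t`. -/
def IsCheapest (u : ℕ → ℕ) (s t e : ℕ) : Prop :=
  s ≤ e ∧ e < t ∧ ∀ x, s ≤ x → x < t → u e ≤ u x

theorem IsLeader.step {m : ℕ} {u mark : ℕ → ℕ} {v a : ℕ} (hv : v + 1 < m)
    (h : IsLeader m u mark (v + 1) a) (hm : mark (v + 1) = 0) :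
    IsLeader m u mark v (if u a < u v then a else v) := by
  obtain ⟨⟨h1, h2, h3⟩, h4⟩ := h
  have h5 : ∀ e, v ≤ e → e < m → (∀ y, v < y → y ≤ e → mark y = 0) → e = v ∨ u a ≤ u e := by
    intro e he hem hy
    by_cases hev : e = v
    · exact Or.inl hev
    · exact Or.inr (h4 e (by omega) hem fun y hy1 hy2 => hy y (by omega) hy2)
  split_ifs with hlt
  · refine ⟨⟨by omega, h2, fun y hy1 hy2 => ?_⟩, fun e he hem hy => ?_⟩
    · by_cases hyv : y = v + 1
      · rw [hyv, hm]
      · exact h3 y (by omega) hy2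
    · rcases h5 e he hem hy with rfl | h
      · exact hlt.le
      · exact h
  · refine ⟨⟨le_rfl, by omega, fun y _ _ => by omega⟩, fun e he hem hy => ?_⟩
    rcases h5 e he hem hy with rfl | h <;> omega

theorem isLeader_self {m : ℕ} {u mark : ℕ → ℕ} {v : ℕ} (hv : v < m) (hm : mark (v + 1) ≠ 0) :
    IsLeader m u mark v v := by
  refine ⟨⟨le_rfl, hv, fun y _ _ => by omega⟩, fun e he _ hy => ?_⟩
  rcases Nat.eq_or_lt_of_le he with rfl | h
  · exact le_rfl
  · exact absurd (hy (v + 1) (by omega) (by omega)) hm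

variable {M n m : ℕ} {σ : State}

theorem run_markEnds (hM : 2 ≤ M) (hn : n ≤ M) (h0 : σ.reg 0 = n) (h1 : σ.reg 1 = m)
    (h6 : σ.arr 6 = fun _ => 0) :
    Run M 20 markEnds σ (20 * n + 20) (fun σ' => ∀ y,
      σ'.arr 6 y ≠ 0 ↔ y = m ∨ ∃ j < n, y = σ.arr 1 j ∨ y = σ.arr 2 j) := by
  refine Run.mono (T₁ := 3 + (n * (8 + 8) + 6)) (Run.seq ?_) (by omega) (fun _ _ h => h)
  refine (Run.store hM (by decide) (by simp; omega) ?_).mono (Q := fun σ₁ =>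
    ∀ y, σ₁.arr 6 y ≠ 0 ↔ y = m) (by decide) fun σ₁ hf₁ h₁ => ?_
  · intro y
    simp [h1, h6, Function.update_apply]
  refine (Run.forLoop (N := n) (Tb := 8) (fun j σ' => ∀ y, σ'.arr 6 y ≠ 0 ↔ y = m ∨ ∃ j' < j,
    y = σ.arr 1 j' ∨ y = σ.arr 2 j') hM (by omega) hn ((hf₁.1 0 rfl).trans h0)
    (by decide) rfl rfl ?_ ?_).mono le_rfl (fun _ _ h => h)
  · intro y
    simpa using h₁ y
  intro j hj σ₂ hf₂ hx hinv
  refine (Run.of_wp hM (by decide) ?_).mono (by decide) (fun _ _ h => h)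
  simp only [Prog.wp, Expr.eval_get, Expr.eval_reg, Expr.eval_ofNat, State.setArr_reg]
  refine ⟨by omega, by omega, fun y => ?_⟩
  have e1 : σ₂.arr 1 = σ.arr 1 := (hf₂.2 1 rfl).trans (hf₁.2 1 rfl)
  have e2 : σ₂.arr 2 = σ.arr 2 := (hf₂.2 2 rfl).trans (hf₁.2 2 rfl)
  have hlast : (∃ j' < j + 1, y = σ.arr 1 j' ∨ y = σ.arr 2 j') ↔
      (∃ j' < j, y = σ.arr 1 j' ∨ y = σ.arr 2 j') ∨ y = σ.arr 1 j ∨ y = σ.arr 2 j := by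
    constructor
    · rintro ⟨j', hj', h⟩
      rcases Nat.lt_succ_iff_lt_or_eq.1 hj' with hj' | rfl
      · exact Or.inl ⟨j', hj', h⟩
      · exact Or.inr h
    · rintro (⟨j', hj', h⟩ | h)
      · exact ⟨j', by omega, h⟩
      · exact ⟨j, by omega, h⟩
  have h := hinv y
  simp only [State.setReg_arr, State.setArr_arr, hx, e1, e2, if_true, Function.update_apply,
    hlast, Nat.reduceEqDiff, if_false]
  split_ifs <;> simp_all

theorem run_sweep (hM : 2 ≤ M) (hm : m ≤ M) (h1 : σ.reg 1 = m) (h6 : σ.arr 6 m ≠ 0) :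
    Run M 20 (forLoop 2 1 sweepBody) σ (60 * m + 6) (fun σ' =>
      ∀ x < m, IsLeader m (σ.arr 0) (σ.arr 6) x (σ'.arr 7 x)) := by
  refine (Run.forLoop (N := m) (Tb := 50) (fun j σ' => ∀ x < m, m ≤ x + j →
    IsLeader m (σ.arr 0) (σ.arr 6) x (σ'.arr 7 x)) hM (by omega) hm h1 (by decide) rfl rfl
    (fun x hx h => by omega) ?_).mono (by omega) (fun σ' _ h x hx => h x hx (by omega))
  intro j hj σ₁ hf hx hinv
  refine (Run.of_wp hM (by decide) ?_).mono (by decide) (fun _ _ h => h)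
  have e0 : σ₁.arr 0 = σ.arr 0 := hf.2 0 rfl
  have e6 : σ₁.arr 6 = σ.arr 6 := hf.2 6 rfl
  have e1 : σ₁.reg 1 = m := (hf.1 1 rfl).trans h1
  obtain ⟨v, hv⟩ : ∃ v, v = m - (j + 1) := ⟨_, rfl⟩
  have hvv : (Expr.reg 1 - (Expr.reg 2 + 1)).eval σ₁ = v := by simp [e1, hx, hv]
  have hinv' := fun x (hx : x < m) (h : v + 1 ≤ x) => hinv x hx (by omega)
  have hold : ∀ a, IsLeader m (σ.arr 0) (σ.arr 6) v a → ∀ x < m, m ≤ x + (j + 1) →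
      IsLeader m (σ.arr 0) (σ.arr 6) x (if x = v then a else σ₁.arr 7 x) := by
    intro a ha x hx hxj
    split_ifs with h
    · rw [h]; exact ha
    · exact hinv' x hx (by omega)
  simp only [sweepBody, Prog.wp, hvv]
  refine ⟨by omega, ?_, fun hne => ⟨?_, ?_⟩, fun heq => ?_⟩
  · simp; omega
  · simp at hne ⊢
    have hv1 : v + 1 < m := by
      by_contra hcon
      have : v + 1 = m := by omega
      rw [this, e6] at hne
      exact h6 hne.2
    have := (hinv' (v + 1) hv1 le_rfl).1.2.1
    omega
  · simp [Function.update_apply, e0, e6] at hne ⊢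
    have hv1 : v + 1 < m := by
      by_contra hcon
      have : v + 1 = m := by omega
      rw [this] at hne
      exact h6 hne.2
    have := (hinv' (v + 1) hv1 le_rfl).step hv1 hne.2
    rw [if_pos hne.1] at this
    intro x hx hxj
    have := hold _ this x hx hxj
    split_ifs at this ⊢ <;> simp_all
  · simp [Function.update_apply, e0, e6] at heq ⊢
    refine hold v ?_
    by_cases hmk : σ.arr 6 (v + 1) = 0
    · have hv1 : v + 1 < m := by
        by_contra hcon
        have : v + 1 = m := by omega
        rw [this] at hmk
        exact h6 hmk
      have := (hinv' (v + 1) hv1 le_rfl).step hv1 hmk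
      rwa [if_neg fun h => heq h hmk] at this
    · exact isLeader_self (by omega) hmk

/-- The cheapest edge between `s` and `t` is found among the leaders of marked vertices. -/
theorem isCheapest_of_leaders {u mark lead : ℕ → ℕ} {s t e : ℕ}
    (hl : ∀ x < m, IsLeader m u mark x (lead x)) (hs : mark s ≠ 0) (ht : t ≤ m) (hse : s ≤ e)
    (het : e < t) (h : ∀ p, mark p ≠ 0 → s ≤ p → p < t → u e ≤ u (lead p)) :
    IsCheapest u s t e := by
  refine ⟨hse, het, fun x hsx hxt => ?_⟩
  set p := Nat.findGreatest (fun p => mark p ≠ 0) x with hp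
  have hpx : p ≤ x := Nat.findGreatest_le x
  have hsp : s ≤ p := Nat.le_findGreatest hsx hs
  have hmp : mark p ≠ 0 := Nat.findGreatest_spec (P := fun p => mark p ≠ 0) hsx hs
  refine (h p hmp hsp (by omega)).trans ((hl p (by omega)).2 x hpx (by omega) fun y hy hyx => ?_)
  simpa using Nat.findGreatest_is_greatest hy hyx

theorem run_tryVertex (hM : 2 ≤ M) (hmM : m ≤ M) {mark : ℕ → ℕ} {i j a : ℕ}
    (hl : ∀ x < m, IsLeader m (σ.arr 0) mark x (σ.arr 7 x)) (h2 : σ.reg 2 = i) (h3 : σ.reg 3 = j)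
    (ht : σ.arr 2 i ≤ m) (hmt : mark (σ.arr 2 i) ≠ 0) (ha : a ≤ 2) (haM : σ.arr a j ≤ M)
    (hr : σ.arr 1 i ≤ σ.reg 4 ∧ σ.reg 4 < σ.arr 2 i) :
    Run M 20 (tryVertex a) σ 40 (fun σ' => (σ.arr 1 i ≤ σ'.reg 4 ∧ σ'.reg 4 < σ.arr 2 i) ∧
      σ.arr 0 (σ'.reg 4) ≤ σ.arr 0 (σ.reg 4) ∧ (σ.arr 1 i ≤ σ.arr a j → σ.arr a j < σ.arr 2 i →
        σ.arr 0 (σ'.reg 4) ≤ σ.arr 0 (σ.arr 7 (σ.arr a j)))) := by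
  refine (Run.of_wp hM ?_ ?_).mono ?_ (fun _ _ h => h)
  · interval_cases a <;> decide
  · simp only [tryVertex, Prog.wp, Expr.eval_get, Expr.eval_reg, h3]
    refine ⟨haM, fun hne => ?_, fun heq => ?_⟩
    · simp [h2] at hne ⊢
      obtain ⟨hx3, hx2, hx1⟩ := hne
      obtain ⟨⟨hl1, hl2, hl3⟩, -⟩ := hl (σ.arr a j) (by omega)
      have hlt : σ.arr 7 (σ.arr a j) < σ.arr 2 i := by
        by_contra hcon
        exact hmt (hl3 _ hx2 (by omega))
      omega
    · simp [h2] at heq ⊢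
      refine ⟨hr, fun h4 h5 => ?_⟩
      by_contra hcon
      have := heq (by omega)
      omega
  · interval_cases a <;> decide

theorem run_bottlenecks (hM : 2 ≤ M) (hnM : n ≤ M) (hmM : m ≤ M) (h0 : σ.reg 0 = n)
    (h1 : σ.reg 1 = m) (hst : ∀ i < n, σ.arr 1 i < σ.arr 2 i ∧ σ.arr 2 i ≤ m)
    (hu : ∀ x, σ.arr 0 x ≤ M) (h6 : σ.arr 6 = fun _ => 0) (h9 : σ.arr 9 = fun _ => 0) :
    Run M 20 bottlenecks σ (200 * (n ^ 2 + n + m + 1)) (fun σ' =>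
      (∀ i < n, IsCheapest (σ.arr 0) (σ.arr 1 i) (σ.arr 2 i) (σ'.arr 8 i) ∧
        σ'.arr 9 i = σ.arr 0 (σ'.arr 8 i)) ∧ σ'.arr 9 n = 0) := by
  refine Run.mono (T₁ := (20 * n + 20) + ((60 * m + 6) +
    (n * ((10 + ((n * (80 + 8) + 6) + 20)) + 8) + 6))) (Run.seq ?_) (by ring_nf; omega)
    (fun _ _ h => h)
  refine (run_markEnds hM hnM h0 h1 h6).mono le_rfl fun σ₁ hf₁ hmark => Run.seq ?_
  refine (run_sweep hM hmM ((hf₁.1 1 rfl).trans h1) ((hmark m).2 (Or.inl rfl))).mono le_rfl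
    fun σ₂ hf₂ hlead => ?_
  set mark := σ₁.arr 6 with hmk
  have e0 : σ₂.arr 0 = σ.arr 0 := (hf₂.2 0 rfl).trans (hf₁.2 0 rfl)
  have e1 : σ₂.arr 1 = σ.arr 1 := (hf₂.2 1 rfl).trans (hf₁.2 1 rfl)
  have e2 : σ₂.arr 2 = σ.arr 2 := (hf₂.2 2 rfl).trans (hf₁.2 2 rfl)
  have e9 : σ₂.arr 9 = fun _ => 0 := (hf₂.2 9 rfl).trans ((hf₁.2 9 rfl).trans h9)
  have r0 : σ₂.reg 0 = n := (hf₂.1 0 rfl).trans ((hf₁.1 0 rfl).trans h0)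
  rw [hf₁.2 0 rfl] at hlead
  refine (Run.forLoop (N := n) (fun j σ' =>
    (∀ i < j, IsCheapest (σ.arr 0) (σ.arr 1 i) (σ.arr 2 i) (σ'.arr 8 i) ∧
        σ'.arr 9 i = σ.arr 0 (σ'.arr 8 i)) ∧ ∀ i, j ≤ i → σ'.arr 9 i = 0) hM (by omega) hnM r0
      (by decide) rfl rfl ⟨by omega, by simp [e9]⟩ ?_).mono le_rfl
      (fun σ' _ h => ⟨h.1, h.2 n le_rfl⟩)
  intro i hi σ₃ hf₃ h2₃ hinv
  have e0 : σ₃.arr 0 = σ.arr 0 := (hf₃.2 0 rfl).trans e0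
  have e1 : σ₃.arr 1 = σ.arr 1 := (hf₃.2 1 rfl).trans e1
  have e2 : σ₃.arr 2 = σ.arr 2 := (hf₃.2 2 rfl).trans e2
  have e7 : σ₃.arr 7 = σ₂.arr 7 := hf₃.2 7 rfl
  have r0 : σ₃.reg 0 = n := (hf₃.1 0 rfl).trans r0
  rw [← e7] at hlead
  obtain ⟨hi1, hi2⟩ := hst i hi
  have hms : mark (σ.arr 1 i) ≠ 0 := (hmark _).2 (Or.inr ⟨i, hi, Or.inl rfl⟩)
  have hmt : mark (σ.arr 2 i) ≠ 0 := (hmark _).2 (Or.inr ⟨i, hi, Or.inr rfl⟩)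
  have hfirst : σ.arr 1 i ≤ σ₃.arr 7 (σ.arr 1 i) ∧ σ₃.arr 7 (σ.arr 1 i) < σ.arr 2 i := by
    obtain ⟨⟨hl1, hl2, hl3⟩, -⟩ := hlead (σ.arr 1 i) (by omega)
    refine ⟨hl1, ?_⟩
    by_contra hcon
    exact hmt (hl3 _ hi1 (by omega))
  refine Run.seq ?_
  refine (Run.of_wp hM (by decide) (Q := fun σ₄ => σ₄ = σ₃.setReg 4 (σ₃.arr 7 (σ.arr 1 i))) ?_).mono
    (by decide) fun σ₄ hf₄ h₄ => Run.seq ?_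
  · simp only [Prog.wp, Expr.eval_get, Expr.eval_reg, h2₃, e1]
    exact ⟨by omega, trivial⟩
  refine (Run.forLoop (N := n) (Tb := 80) (fun j σ' =>
    (σ.arr 1 i ≤ σ'.reg 4 ∧ σ'.reg 4 < σ.arr 2 i) ∧ ∀ j' < j, ∀ p, p = σ.arr 1 j' ∨ p = σ.arr 2 j' →
      σ.arr 1 i ≤ p → p < σ.arr 2 i → σ.arr 0 (σ'.reg 4) ≤ σ.arr 0 (σ₃.arr 7 p)) hM (by omega) hnM
    (by simp [h₄, r0]) (by decide) rfl rfl ⟨by simpa [h₄] using hfirst, by omega⟩ ?_).mono le_rfl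
    fun σ₅ hf₅ h₅ => ?_
  · intro j hj σ₅ hf₅ h3₅ h₅
    have e0 : σ₅.arr 0 = σ.arr 0 := (hf₅.2 0 rfl).trans ((hf₄.2 0 rfl).trans e0)
    have e1 : σ₅.arr 1 = σ.arr 1 := (hf₅.2 1 rfl).trans ((hf₄.2 1 rfl).trans e1)
    have e2 : σ₅.arr 2 = σ.arr 2 := (hf₅.2 2 rfl).trans ((hf₄.2 2 rfl).trans e2)
    have e7 : σ₅.arr 7 = σ₃.arr 7 := (hf₅.2 7 rfl).trans (hf₄.2 7 rfl)
    have r2 : σ₅.reg 2 = i := (hf₅.1 2 rfl).trans ((hf₄.1 2 rfl).trans h2₃)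
    obtain ⟨hj1, hj2⟩ := hst j hj
    refine Run.mono (T₁ := 40 + 40) (Run.seq ?_) (by omega) (fun _ _ h => h)
    refine (run_tryVertex (m := m) (mark := mark) hM hmM (by rw [e0, e7]; exact hlead) r2 h3₅
      (by rw [e2]; exact hi2) (by rw [e2]; exact hmt) (by omega) (by rw [e1]; omega)
      (by rw [e1, e2]; exact h₅.1)).mono le_rfl fun σ₆ hf₆ h₆ => ?_
    rw [e0, e1, e2, e7] at h₆
    have e0' : σ₆.arr 0 = σ.arr 0 := (hf₆.2 0 rfl).trans e0
    have e1' : σ₆.arr 1 = σ.arr 1 := (hf₆.2 1 rfl).trans e1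
    have e2' : σ₆.arr 2 = σ.arr 2 := (hf₆.2 2 rfl).trans e2
    have e7' : σ₆.arr 7 = σ₃.arr 7 := (hf₆.2 7 rfl).trans e7
    refine (run_tryVertex (m := m) (mark := mark) hM hmM (by rw [e0', e7']; exact hlead)
      ((hf₆.1 2 rfl).trans r2) ((hf₆.1 3 rfl).trans h3₅)
      (by rw [e2']; exact hi2) (by rw [e2']; exact hmt) (by omega) (by rw [e2']; omega)
      (by rw [e1', e2']; exact h₆.1)).mono le_rfl fun σ₇ hf₇ h₇ => ?_
    rw [e0', e1', e2', e7'] at h₇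
    have hreg : (σ₇.setReg 3 (j + 1)).reg 4 = σ₇.reg 4 := by simp
    rw [hreg]
    refine ⟨h₇.1, fun j' hj' p hp hp1 hp2 => ?_⟩
    rcases Nat.lt_succ_iff_lt_or_eq.1 hj' with hj' | rfl
    · exact (h₇.2.1.trans h₆.2.1).trans (h₅.2 j' hj' p hp hp1 hp2)
    · rcases hp with rfl | rfl
      · exact h₇.2.1.trans (h₆.2.2 hp1 hp2)
      · exact h₇.2.2 hp1 hp2
  · have e0 : σ₅.arr 0 = σ.arr 0 := (hf₅.2 0 rfl).trans ((hf₄.2 0 rfl).trans e0)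
    have e8 : σ₅.arr 8 = σ₃.arr 8 := (hf₅.2 8 rfl).trans (hf₄.2 8 rfl)
    have e9 : σ₅.arr 9 = σ₃.arr 9 := (hf₅.2 9 rfl).trans (hf₄.2 9 rfl)
    have r2 : σ₅.reg 2 = i := (hf₅.1 2 rfl).trans ((hf₄.1 2 rfl).trans h2₃)
    have hch : IsCheapest (σ.arr 0) (σ.arr 1 i) (σ.arr 2 i) (σ₅.reg 4) := by
      refine isCheapest_of_leaders hlead hms hi2 h₅.1.1 h₅.1.2 fun p hp hp1 hp2 => ?_
      rcases (hmark p).1 hp with rfl | ⟨j, hj, hpj⟩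
      · omega
      · exact h₅.2 j hj p hpj hp1 hp2
    refine (Run.of_wp hM (by decide) ?_).mono (by decide) (fun _ _ h => h)
    simp only [Prog.wp, Expr.eval_get, Expr.eval_reg, State.setArr_reg, r2]
    refine ⟨by omega, ?_, fun i' hi' => ?_, fun i' hi' => ?_⟩
    · simpa [e0] using hu _
    · rcases Nat.lt_succ_iff_lt_or_eq.1 hi' with hi' | rfl
      · simpa [Function.update_apply, hi'.ne, e8, e9] using hinv.1 i' hi'
      · simpa [Function.update_apply, e0] using hch
    · have : i' ≠ i := by omega
      simpa [Function.update_apply, this, e9] using hinv.2 i' (by omega)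

end WordRAM

namespace UFPP

open WordRAM

/-! ### The algorithm -/

/-- The tasks of `K` other than the dummy are those of `I`. -/
structure Represents (K : Boxes) (I : UFPP) : Prop where
  n : K.n = I.n
  s : ∀ i : Fin I.n, K.s i = I.s i
  t : ∀ i : Fin I.n, K.t i = I.t i
  d : ∀ i : Fin I.n, K.d i = I.d i
  w : ∀ i : Fin I.n, K.w i = I.w i
  b : ∀ i : Fin I.n, K.b i = I.b i

theorem cells_val {k : ℕ} (f : Fin k → ℕ) (i : Fin k) : cells f i = f i := by
  simp [cells]

theorem b_eq_of_isCheapest {I : UFPP} (i : Fin I.n) {e : ℕ}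
    (h : IsCheapest (cells I.u) (I.s i) (I.t i) e) : cells I.u e = I.b i := by
  obtain ⟨h1, h2, h3⟩ := h
  have hm := (I.t i).isLt
  obtain ⟨E, hE, -⟩ := I.exists_bottleneck
  have hu := uses_iff.1 (hE.uses i)
  refine le_antisymm ?_ ?_
  · have := h3 (E i) hu.1 (by omega)
    rwa [cells_val, hE.u_eq] at this
  · have hem : e < I.m := by omega
    have : cells I.u e = I.u ⟨e, hem⟩ := cells_val I.u ⟨e, hem⟩
    rw [this]
    exact b_le_of_uses (uses_iff.2 ⟨h1, h2⟩)

theorem exists_boxes (I : UFPP) (hd : ∀ i, 0 < I.d i) {σ : State}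
    (h0 : σ.reg 0 = I.n) (h9 : σ.reg 9 = I.n + 1)
    (h1 : σ.arr 1 = Function.update (cells fun i => (I.s i : ℕ)) I.n I.m)
    (h2 : σ.arr 2 = cells fun i => (I.t i : ℕ)) (h3 : σ.arr 3 = cells I.d)
    (h4 : σ.arr 4 = cells I.w)
    (hb : ∀ i : Fin I.n, IsCheapest (cells I.u) (I.s i) (I.t i) (σ.arr 8 i) ∧
      σ.arr 9 i = cells I.u (σ.arr 8 i)) (hbn : σ.arr 9 I.n = 0) :
    ∃ K : Boxes, Holds K σ ∧ Represents K I := by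
  have es : ∀ i : Fin I.n, σ.arr 1 i = I.s i := fun i => by
    rw [h1, Function.update_of_ne i.isLt.ne, cells_val]
  have et : ∀ i : Fin I.n, σ.arr 2 i = I.t i := fun i => by rw [h2, cells_val]
  have ed : ∀ i : Fin I.n, σ.arr 3 i = I.d i := fun i => by rw [h3, cells_val]
  have ew : ∀ i : Fin I.n, σ.arr 4 i = I.w i := fun i => by rw [h4, cells_val]
  refine ⟨{
    n := I.n
    s := σ.arr 1
    t := σ.arr 2
    d := σ.arr 3
    w := σ.arr 4
    e := σ.arr 8
    b := σ.arr 9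
    s_le_e := fun i hi => ?_
    e_lt_t := fun i hi => ?_
    d_pos := fun i hi => ?_
    b_le := fun i hi j hj hs ht => ?_
    t_n := ?_
    b_n := hbn
    le_s_n := fun i hi => ?_ }, ⟨h0, h9, rfl, rfl, rfl, rfl, rfl, rfl⟩, rfl, es, et, ed, ew,
      fun i => (hb i).2.trans (b_eq_of_isCheapest i (hb i).1)⟩
  · rw [es ⟨i, hi⟩]; exact (hb ⟨i, hi⟩).1.1
  · rw [et ⟨i, hi⟩]; exact (hb ⟨i, hi⟩).1.2.1
  · rw [ed ⟨i, hi⟩]; exact hd _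
  · rw [es ⟨j, hj⟩] at hs
    rw [et ⟨j, hj⟩] at ht
    rw [(hb ⟨i, hi⟩).2, (hb ⟨j, hj⟩).2]
    exact (hb ⟨j, hj⟩).1.2.2 _ hs ht
  · simp [h2, cells]
  · rw [et ⟨i, hi⟩, h1, Function.update_self]
    have := (I.t ⟨i, hi⟩).isLt
    omega

theorem Represents.indep_iff {K : Boxes} {I : UFPP} (h : Represents K I) (F : Finset (Fin I.n)) :
    K.Indep K.n K.n (F.map Fin.valEmbedding) ↔ I.IsITS F := by
  have hlt : ∀ i : Fin I.n, (i : ℕ) < K.n := fun i => i.isLt.trans_eq h.n.symm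
  have hl : (∀ j ∈ F.map Fin.valEmbedding, j < K.n ∧ K.Between K.n K.n j) ↔ ∀ i ∈ F, 0 ≤ I.l i := by
    simp only [Finset.forall_mem_map]
    refine forall₂_congr fun i _ => ?_
    rw [Fin.valEmbedding_apply, K.between_n (hlt i), h.d, h.b, l]
    have := hlt i
    omega
  rw [Boxes.Indep, IsITS, hl]
  refine and_congr_right fun hF => ?_
  simp only [Finset.forall_mem_map, Fin.valEmbedding_apply]
  refine forall₂_congr fun i hi => forall₂_congr fun j hj => ?_
  rw [ne_eq, ne_eq, Fin.val_inj]
  refine imp_congr_right fun _ => ?_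
  have h1 := hF i hi
  have h2 := hF j hj
  rw [compatible_iff, Boxes.Compat, Boxes.l, Boxes.l, h.s, h.s, h.t, h.t, h.b, h.b, h.d, h.d]
  unfold Meets l at *
  omega

theorem Represents.sum_map {K : Boxes} {I : UFPP} (h : Represents K I) (F : Finset (Fin I.n)) :
    ∑ j ∈ F.map Fin.valEmbedding, K.w j = I.profit F := by
  rw [Finset.sum_map]
  exact Finset.sum_congr rfl fun i _ => h.w i

theorem Represents.isMaxITS {K : Boxes} {I : UFPP} (h : Represents K I) {S : Finset (Fin I.n)}
    {v : ℕ} (hS : K.Indep K.n K.n (S.map Fin.valEmbedding))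
    (hv : ∑ j ∈ S.map Fin.valEmbedding, K.w j = v) (hb : K.Bounds v K.n K.n) : I.IsMaxITS S := by
  refine ⟨(h.indep_iff S).1 hS, fun F hF => ?_⟩
  rw [← h.sum_map F, ← h.sum_map S, hv]
  exact hb _ ((h.indep_iff F).2 hF)

/-- Store the start vertex of the dummy task, and the length of the rows of the tables. -/
def wall : Prog := .seq (.store 1 (.reg 0) (.reg 1)) (.assign 9 (.reg 0 + 1))

/-- Read the solution from the table entry that belongs to the whole path. -/
def report : Prog := forLoop 2 0 (.store 5 (.reg 2) (.get 12 (tripleIdx 0 0 2)))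

/-- Compute an independent task set of maximum profit. -/
def maxITS : Prog := .seq bottlenecks (.seq wall (.seq rounds report))

theorem run_report {K : Boxes} {M : ℕ} {σ : State} (hM : 2 ≤ M) (hn : K.n ≤ M) (h : Holds K σ)
    (hb : σ.Bdd M) :
    Run M 20 report σ (K.n * (20 + 8) + 6) (fun σ' =>
      ∀ j < K.n, σ'.arr 5 j = ind K σ K.n K.n j) := by
  refine Run.forLoop (N := K.n) (Tb := 20) (fun i σ' => ∀ j < i, σ'.arr 5 j = ind K σ K.n K.n j) hM
    (by omega) hn h.n (by decide) rfl rfl (by omega) ?_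
  intro j hj σ' hf hx hinv
  have e : (Expr.get 12 (tripleIdx 0 0 2)).eval σ' = ind K σ K.n K.n j := by
    simp [tripleIdx, pairIdx, ind, hf.1 0 rfl, hf.1 9 rfl, hf.2 12 rfl, h.n, h.len, hx]
  refine (Run.store hM (by decide) ?_ ?_).mono (by decide) (fun _ _ h => h)
  · rw [e]; exact hb.2 _ _
  · intro j' hj'
    rw [e]
    rcases Nat.lt_succ_iff_lt_or_eq.1 hj' with hj' | rfl
    · simpa [hx, Function.update_apply, hj'.ne] using hinv j' hj'
    · simp [hx]

theorem cells_le {k M : ℕ} {f : Fin k → ℕ} (h : ∀ i, f i ≤ M) (j : ℕ) : cells f j ≤ M := by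
  unfold cells
  split_ifs
  exacts [h _, Nat.zero_le _]

theorem input_bdd (I : UFPP) {M : ℕ} (hM : I.magnitude ≤ M) : I.input.Bdd M := by
  unfold magnitude at hM
  have hsum : ∀ {k : ℕ} (f : Fin k → ℕ), ∑ i, f i ≤ M → ∀ j, cells f j ≤ M := fun f hf =>
    cells_le fun i => (Finset.single_le_sum (fun _ _ => Nat.zero_le _) (Finset.mem_univ i)).trans hf
  refine ⟨fun x => ?_, fun a j => ?_⟩
  · match x with
    | 0 => change I.n ≤ M; omega
    | 1 => change I.m ≤ M; omega
    | _ + 2 => exact Nat.zero_le _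
  · match a with
    | 0 => exact hsum I.u (by omega) j
    | 1 => exact cells_le (f := fun i => (I.s i : ℕ)) (fun i => by have := (I.s i).isLt; omega) j
    | 2 => exact cells_le (f := fun i => (I.t i : ℕ)) (fun i => by have := (I.t i).isLt; omega) j
    | 3 => exact hsum I.d (by omega) j
    | 4 => exact hsum I.w (by omega) j
    | _ + 5 => exact Nat.zero_le _

/-- Besides numbers from the input and loop counters, the memory only holds sums of the profits of three
sets of tasks, so that its entries are bounded by the square of the magnitude; intermediate results, such
as the indices into the tables, are at most the 20th power of this bound. -/
theorem run_maxITS (I : UFPP) (hd : ∀ i, 0 < I.d i) :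
    Run (I.magnitude ^ 2) 20 maxITS I.input (5000 * (I.n ^ 4 + I.m + 1))
      (fun σ => I.IsMaxITS (I.output σ)) := by
  set M := I.magnitude ^ 2 with hMdef
  have hmag : I.n + I.m + ∑ i, I.w i + 2 ≤ I.magnitude := by unfold magnitude; omega
  have hMM : I.magnitude ≤ M := Nat.le_self_pow (by omega) _
  have hM : 2 ≤ M := by omega
  have hT : 200 * (I.n ^ 2 + I.n + I.m + 1) + (10 + (4000 * (I.n ^ 4 + 1) +
      (I.n * (20 + 8) + 6))) ≤ 5000 * (I.n ^ 4 + I.m + 1) := by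
    have h1 : I.n ≤ I.n ^ 4 := Nat.le_self_pow (by omega) _
    have h2 : I.n ^ 2 ≤ I.n ^ 4 := by
      rcases Nat.eq_zero_or_pos I.n with h0 | h0
      · simp [h0]
      · exact Nat.pow_le_pow_right h0 (by omega)
    omega
  have es : ∀ i : Fin I.n, I.input.arr 1 i = I.s i := fun i => cells_val (fun i => (I.s i : ℕ)) i
  have et : ∀ i : Fin I.n, I.input.arr 2 i = I.t i := fun i => cells_val (fun i => (I.t i : ℕ)) i
  refine Run.mono (Run.seq ?_) hT (fun _ _ h => h)
  refine (run_bottlenecks (n := I.n) (m := I.m) hM (by omega) (by omega) rfl rfl (fun i hi => ?_)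
    ((I.input_bdd hMM).2 0) rfl rfl).mono le_rfl fun σ₁ hf₁ h₁ => Run.seq ?_
  · rw [es ⟨i, hi⟩, et ⟨i, hi⟩]
    have h1 : (I.s ⟨i, hi⟩ : ℕ) < I.t ⟨i, hi⟩ := I.s_lt_t _
    have h2 := (I.t ⟨i, hi⟩).isLt
    omega
  have r0 : σ₁.reg 0 = I.n := hf₁.1 0 rfl
  have r1 : σ₁.reg 1 = I.m := hf₁.1 1 rfl
  refine (Run.of_wp hM (by decide) (Q := fun σ₂ =>
    σ₂ = (σ₁.setArr 1 I.n I.m).setReg 9 (I.n + 1)) ?_).mono (by decide) fun σ₂ _ h₂ => Run.seq ?_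
  · simp only [wall, Prog.wp, Expr.eval_reg, Expr.eval_add, Expr.eval_ofNat, State.setArr_reg, r0,
      r1, and_true]
    omega
  have e : ∀ a, a ≠ 1 → σ₂.arr a = σ₁.arr a := fun a ha => by simp [h₂, ha]
  obtain ⟨K, hH, hR⟩ : ∃ K : Boxes, Holds K σ₂ ∧ Represents K I := by
    refine exists_boxes I hd (by simp [h₂, r0]) (by simp [h₂]) ?_ ?_ ?_ ?_ (fun i => ?_) ?_
    · simp only [h₂, State.setReg_arr, State.setArr_arr, if_true]
      rw [hf₁.2 1 rfl]
      rfl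
    · exact (e 2 (by decide)).trans (hf₁.2 2 rfl)
    · exact (e 3 (by decide)).trans (hf₁.2 3 rfl)
    · exact (e 4 (by decide)).trans (hf₁.2 4 rfl)
    · have := h₁.1 i i.isLt
      rw [es, et] at this
      rw [e 8 (by decide), e 9 (by decide)]
      exact this
    · rw [e 9 (by decide)]
      exact h₁.2
  have hsum : ∑ j ∈ Finset.range K.n, K.w j = ∑ i, I.w i := by
    rw [hR.n, Finset.sum_range]
    exact Finset.sum_congr rfl fun i _ => hR.w i
  have hw : 3 * ∑ j ∈ Finset.range K.n, K.w j ≤ M := by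
    rw [hsum, hMdef]
    nlinarith
  -- initially, all entries of the tables are zero and represent the empty set
  have hs : Sound K σ₂ := by
    have h11 : σ₂.arr 11 = fun _ => 0 :=
      (e 11 (by decide)).trans (hf₁.2 11 rfl)
    have h12 : σ₂.arr 12 = fun _ => 0 :=
      (e 12 (by decide)).trans (hf₁.2 12 rfl)
    intro i _ k _
    have : sel K σ₂ i k = ∅ := by simp [sel, ind, h12]
    rw [this]
    exact ⟨⟨by simp, by simp⟩, by simp [val, h11]⟩
  have hn : K.n + 1 ≤ M := by rw [hR.n]; omega
  rw [← hR.n]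
  refine (run_rounds hM hn hw hH hs).mono le_rfl fun σ₃ hf₃ h₃ => ?_
  have hH₃ : Holds K σ₃ := hH.of_frame hf₃ rfl
  intro hb₃
  refine ((run_report hM (by omega) hH₃ hb₃).mono le_rfl fun σ₄ _ h₄ => ?_) hb₃
  have hout : (I.output σ₄).map Fin.valEmbedding = sel K σ₃ K.n K.n := by
    ext j
    simp only [output, sel, Finset.mem_map, Finset.mem_filter, Finset.mem_univ, true_and,
      Finset.mem_range, Fin.valEmbedding_apply]
    constructor
    · rintro ⟨i, hi, rfl⟩
      have hlt : (i : ℕ) < K.n := i.isLt.trans_eq hR.n.symm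
      exact ⟨hlt, by rwa [← h₄ i hlt]⟩
    · rintro ⟨hlt, hi⟩
      exact ⟨⟨j, hlt.trans_eq hR.n⟩, by rwa [← h₄ j hlt] at hi, rfl⟩
  obtain ⟨hind, hval⟩ := h₃.1 K.n le_rfl K.n le_rfl
  rw [← hout] at hind hval
  exact hR.isMaxITS hind hval (h₃.2 K.n le_rfl K.n le_rfl)

end UFPP

theorem mainTheorem2 (k : ℕ) (hk : 2 ≤ k) :
    -- the approximation algorithm: a program, the constant `C` of its running time, and the
    -- constant `c` of its word length of at most `c * log₂ (magnitude) + 1` bits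
    (∃ (P : WordRAM.Prog) (C c : ℕ), ∀ I : UFPP, (∀ i, I.IsLarge (1 / (k : ℚ)) i) →
      ∃ (T : ℕ) (σ : WordRAM.State),
        WordRAM.Exec (I.magnitude ^ c) P I.input T σ ∧
        T ≤ C * (I.n ^ 4 + I.m + 1) ∧
        (I.m < 2 * I.n → T ≤ C * I.n ^ 4) ∧
        I.IsMaxITS (I.output σ) ∧
        I.IsFeasible (I.output σ) ∧
        ∀ F : Finset (Fin I.n), I.IsFeasible F →
          1 / (2 * (k : ℚ)) * (I.profit F : ℚ) ≤ (I.profit (I.output σ) : ℚ)) ∧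
    -- feasible solutions consisting of `1/k`-large tasks partition into `2k` independent task sets
    (∀ (I : UFPP) (F : Finset (Fin I.n)), I.IsFeasible F →
      (∀ i ∈ F, I.IsLarge (1 / (k : ℚ)) i) →
      ∃ α : Fin I.n → Fin (2 * k), ∀ a, I.IsITS (F.filter (fun i => α i = a))) := by
  refine ⟨⟨UFPP.maxITS, 20000, 40, fun I hL => ?_⟩,
    fun I F hF hL => UFPP.exists_partition_isITS hk hF hL⟩
  obtain ⟨T, σ, hT, hexec, -, hmax⟩ := UFPP.run_maxITS I
    (fun i => UFPP.d_pos_of_isLarge hk (hL i)) (I.input_bdd (Nat.le_self_pow (by omega) _))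
  rw [← pow_mul] at hexec
  refine ⟨T, σ, hexec, by omega, fun hm => ?_, hmax, hmax.1.isFeasible,
    fun F hF => UFPP.profit_le_of_isMaxITS hk hL hmax hF⟩
  -- here `n ≥ 1`, so that `m` and the additive constant are absorbed by `n ^ 4`
  have h1 : I.n ≤ I.n ^ 4 := Nat.le_self_pow (by omega) _
  omega
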